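/- Let $\Omega\subset\mathbb{R}^3$ be a bounded Lipschitz polyhedron, that is, a bounded nonempty connected open set whose closure is a finite union of convex polytopes and which, near each of its boundary points and in suitable Cartesian coordinates, is the set of points above the graph of a Lipschitz function. Let $\Gamma_D\subset\partial\Omega$ be a (possibly empty) set with finitely many connected components $\Gamma_1,\dots,\Gamma_m$, such that there are Lipschitz domains (connected open sets satisfying the same local graph condition) $\Omega_1,\dots,\Omega_m\subset\mathbb{R}^3$ with $$\overline{\Omega}_i\cap\overline{\Omega}=\Gamma_i,\qquad \Omega_i\cap\Omega=\emptyset,\qquad \operatorname{dist}(\Omega_i,\Omega_j)>0\quad(i\neq j),$$ and such that the interior of $\overline{\Omega}\cup\overline{\Omega}_1\cup\dots\cup\overline{\Omega}_m$ is a Lipschitz domain, too. Let $H^1_{\Gamma_D}(\Omega)$ be the space of all real-valued $u\in H^1(\Omega)$ whose trace on $\partial\Omega$ vanishes almost everywhere on $\Gamma_D$. Then there is a constant $C=C(\Omega,\Gamma_D)>0$ such that $$\int_\Omega\left|\frac{u(x)}{\operatorname{dist}(x,\Gamma_D)}\right|^2\,dx\;\le\; C\,|u|_{H^1(\Omega)}^2=C\int_\Omega|\nabla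 u(x)|^2\,dx\qquad\text{for all }u\in H^1_{\Gamma_D}(\Omega),$$ where $\operatorname{dist}(x,\emptyset)=\infty$, so that the left-hand side is $0$ if $\Gamma_D=\emptyset$. -/

import Mathlib

open MeasureTheory Set Filter Topology
open scoped ENNReal NNReal ContDiff

namespace HardyMixed

/-- Three-dimensional Euclidean space. -/
abbrev E3 : Type := EuclideanSpace ℝ (Fin 3)

/-- A (strong) Lipschitz domain in `ℝ³`: a nonempty connected open set `U` such that near each of
its boundary points, in suitable Cartesian coordinates (given by the linear isometry `e`), `U` is
the set of points lying strictly above the graph of a Lipschitz function of two variables. -/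
structure IsLipschitzDomain (U : Set E3) : Prop where
  isOpen : IsOpen U
  isConnected : IsConnected U
  graph : ∀ p ∈ frontier U, ∃ (e : E3 ≃ₗᵢ[ℝ] E3) (ψ : EuclideanSpace ℝ (Fin 2) → ℝ) (K : ℝ≥0)
    (V : Set E3), LipschitzWith K ψ ∧ IsOpen V ∧ p ∈ V ∧
      ∀ x ∈ V, (x ∈ U ↔ ψ !₂[e x 0, e x 1] < e x 2)

/-- A bounded Lipschitz polyhedron: a Lipschitz domain whose closure is a finite union of convex
polytopes (convex hulls of finite sets of points). -/
structure IsLipschitzPolyhedron (U : Set E3) : Prop extends IsLipschitzDomain U where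
  polytopes : ∃ T : Finset (Finset E3), closure U = ⋃ t ∈ T, convexHull ℝ (t : Set E3)

/-- The set of connected components of `Γ`. -/
def components (Γ : Set E3) : Set (Set E3) := connectedComponentIn Γ '' Γ

/-- `Γ` is an admissible Dirichlet part of the boundary of `Ω`: it has finitely many connected
components, to each component `S` one can attach a Lipschitz domain `W S` outside `Ω` which meets
the closure of `Ω` exactly in `S`, these domains have pairwise positive distance, and `Ω` together
with all attached domains forms a Lipschitz domain. The case `Γ = ∅` is allowed. -/
structure IsDirichletPart (Ω Γ : Set E3) : Prop where
  subset_frontier : Γ ⊆ frontier Ω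
  finite_components : (components Γ).Finite
  attached : ∃ W : Set E3 → Set E3,
    (∀ S ∈ components Γ, IsLipschitzDomain (W S) ∧
      closure (W S) ∩ closure Ω = S ∧ W S ∩ Ω = ∅) ∧
    (∀ S ∈ components Γ, ∀ T ∈ components Γ, S ≠ T → Metric.AreSeparated (W S) (W T)) ∧
    IsLipschitzDomain (interior (closure Ω ∪ ⋃ S ∈ components Γ, closure (W S)))

/-- `u` belongs to `H¹(Ω)` and `g` is its weak gradient: both are square integrable on `Ω`, and the
integration by parts formula holds for every smooth test function with compact support in `Ω`
and every direction `v`. -/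
structure HasH1Gradient (Ω : Set E3) (u : E3 → ℝ) (g : E3 → E3) : Prop where
  memLp : MemLp u 2 (volume.restrict Ω)
  memLp_gradient : MemLp g 2 (volume.restrict Ω)
  weak : ∀ φ : E3 → ℝ, ContDiff ℝ ∞ φ → HasCompactSupport φ → tsupport φ ⊆ Ω → ∀ v : E3,
    ∫ x in Ω, u x * fderiv ℝ φ x v = - ∫ x in Ω, inner ℝ (g x) v * φ x

/-- The surface measure on the boundary of `Ω` (the two-dimensional Hausdorff measure; its
normalization plays no role below). -/
noncomputable def surfaceMeasure (Ω : Set E3) : Measure E3 :=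
  (Measure.hausdorffMeasure 2).restrict (frontier Ω)

/-- `t ∈ L²(∂Ω)` is the trace of `u ∈ H¹(Ω)` (with weak gradient `g`): the trace map is the
continuous extension of the restriction map `φ ↦ φ|∂Ω` from smooth functions, that is, some
sequence of functions smooth up to the boundary converges to `u` in `H¹(Ω)` while its boundary
values converge to `t` in `L²(∂Ω)`. -/
def HasTrace (Ω : Set E3) (u : E3 → ℝ) (g : E3 → E3) (t : E3 → ℝ) : Prop :=
  MemLp t 2 (surfaceMeasure Ω) ∧
  ∃ φ : ℕ → E3 → ℝ, (∀ n, ContDiff ℝ ∞ (φ n)) ∧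
    Tendsto (fun n => ∫⁻ x in Ω, ‖φ n x - u x‖ₑ ^ 2) atTop (𝓝 0) ∧
    Tendsto (fun n => ∫⁻ x in Ω, ‖gradient (φ n) x - g x‖ₑ ^ 2) atTop (𝓝 0) ∧
    Tendsto (fun n => ∫⁻ x, ‖φ n x - t x‖ₑ ^ 2 ∂(surfaceMeasure Ω)) atTop (𝓝 0)

/-- `u` belongs to `H¹_Γ(Ω)`, the subspace of those functions in `H¹(Ω)` whose trace vanishes
almost everywhere on `Γ ⊆ ∂Ω`; `g` is the weak gradient of `u`. -/
structure MemH1Zero (Ω Γ : Set E3) (u : E3 → ℝ) (g : E3 → E3) : Prop where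
  hasH1Gradient : HasH1Gradient Ω u g
  trace_zero : ∃ t : E3 → ℝ, HasTrace Ω u g t ∧ ∀ᵐ x ∂((surfaceMeasure Ω).restrict Γ), t x = 0

end HardyMixed

namespace HardyMixed

/-! The estimate is local: `closure Ω` is compact and constants add under unions, so it suffices to
bound the weighted integral near each point, uniformly in `u` (`HardyNear`).

Near `p ∈ Γ`, let `W` be the attached domain and `τ` a Lipschitz chart of `W` decreasing at unit
speed along `f`. Starting at `x ∈ Ω`, the segment `x + s • f` reaches `closure W` at time `τ x`, and
`τ x` is at most a constant times the distance to `Γ`. The segment may leave `closure Ω` through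
another part of its boundary. This is where the Lipschitz property of the union `D` enters: a local
Lipschitz retraction `P` onto `closure D` bends the segment into `closure Ω ∪ closure W`, and the
bent path first meets `closure W` at a point of `Γ`. Since the trace vanishes there, `‖u x‖` is
bounded by the integral of the gradient along the path (`MemH1Zero.ae_enorm_le`).

Dividing by `τ x` leaves averages of `G ∘ P` over straight segments, where `G` is the gradient norm
on `closure Ω`. The one-dimensional Hardy inequality, applied on all lines parallel to `f`
(`hardy_directional`), bounds them in `L²` by `G ∘ P`. Because `P` folds by reflection instead of
projecting onto the boundary, it compresses volume only boundedly, so `G ∘ P` is controlled by `G`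
(`lintegral_comp_le`). This gives `hardyNear_of_attached`.

Away from `Γ` the weight is bounded, so an `L²` bound suffices (`PoincareNear`). Such a bound holds
near a point of `Γ` by the above, and it spreads by translations through the connected set `Ω` and
then to its boundary (`IsLipschitzDomain.poincareNear`). -/

/-! ### Smooth functions along Lipschitz paths -/

/-- Variation of a `C¹` function along a Lipschitz path. -/
lemma sub_le_integral_path {φ : E3 → ℝ} (hφ : ContDiff ℝ 1 φ) {γ : ℝ → E3} {L : ℝ≥0}
    (hγ : LipschitzWith L γ) {a b : ℝ} (hab : a ≤ b) :
    φ (γ b) - φ (γ a) ≤ ∫ s in a..b, L * ‖fderiv ℝ φ (γ s)‖ := by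
  have hc : Continuous fun s => (L : ℝ) * ‖fderiv ℝ φ (γ s)‖ :=
    continuous_const.mul (((hφ.continuous_fderiv one_ne_zero).comp hγ.continuous).norm)
  refine image_le_of_liminf_slope_right_le_deriv_boundary
    (f := fun s => φ (γ s) - φ (γ a)) (a := a) (b := b)
    (B := fun t => ∫ s in a..t, L * ‖fderiv ℝ φ (γ s)‖)
    (B' := fun s => L * ‖fderiv ℝ φ (γ s)‖) ?_ ?_ ?_ ?_ ?_ ⟨hab, le_rfl⟩
  · exact ((hφ.continuous.comp hγ.continuous).sub continuous_const).continuousOn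
  · simp
  · exact (intervalIntegral.continuous_primitive (fun _ _ => hc.intervalIntegrable _ _) a).continuousOn
  · intro x _
    exact (hc.integral_hasStrictDerivAt a x).hasDerivAt.hasDerivWithinAt
  · intro x _ r hr
    -- `γ` need not be differentiable; the right slope is bounded instead by `L * k`, with `k` a
    -- Lipschitz constant of `φ` near `γ x` slightly above the norm of its derivative.
    obtain ⟨k, hk1, hk2⟩ : ∃ k : ℝ≥0, ‖fderiv ℝ φ (γ x)‖₊ < k ∧ (L : ℝ) * k < r := by
      have h1 : Tendsto (fun k : ℝ => (L : ℝ) * k) (𝓝[>] ‖fderiv ℝ φ (γ x)‖)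
          (𝓝 (L * ‖fderiv ℝ φ (γ x)‖)) :=
        ((continuous_const.mul continuous_id).tendsto _).mono_left nhdsWithin_le_nhds
      obtain ⟨k, hk1, hk2⟩ := ((h1.eventually (gt_mem_nhds hr)).and self_mem_nhdsWithin).exists
      exact ⟨⟨k, (norm_nonneg _).trans (le_of_lt hk2)⟩, hk2, hk1⟩
    obtain ⟨s, hs, hlip⟩ := (hφ.contDiffAt.hasStrictFDerivAt
      one_ne_zero).exists_lipschitzOnWith_of_nnnorm_lt k hk1
    have hs' : ∀ᶠ z in 𝓝[>] x, γ z ∈ s :=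
      nhdsWithin_le_nhds (hγ.continuous.continuousAt hs)
    refine Eventually.frequently ?_
    filter_upwards [hs', self_mem_nhdsWithin] with z hz hxz
    have hxz' : 0 < z - x := sub_pos.2 hxz
    have h2 := hlip.dist_le_mul _ hz _ (mem_of_mem_nhds hs)
    have h3 := hγ.dist_le_mul z x
    rw [Real.dist_eq] at h2
    rw [Real.dist_eq, abs_of_pos hxz'] at h3
    have h4 : φ (γ z) - φ (γ x) ≤ L * k * (z - x) := by
      refine (le_abs_self _).trans (h2.trans ?_)
      calc (k : ℝ) * dist (γ z) (γ x) ≤ k * (L * (z - x)) := by gcongr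
        _ = _ := by ring
    refine lt_of_le_of_lt ?_ hk2
    rw [slope_def_field, div_le_iff₀ hxz']
    linarith

lemma norm_gradient (φ : E3 → ℝ) (x : E3) : ‖gradient φ x‖ = ‖fderiv ℝ φ x‖ := by
  simp [gradient]

lemma enorm_sub_le_lintegral_path {φ : E3 → ℝ} (hφ : ContDiff ℝ ∞ φ) {γ : ℝ → E3} {L : ℝ≥0}
    (hγ : LipschitzWith L γ) {a b : ℝ} (hab : a ≤ b) :
    ‖φ (γ b) - φ (γ a)‖ₑ ≤ L * ∫⁻ s in Ioc a b, ‖gradient φ (γ s)‖ₑ := by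
  have hφ1 : ContDiff ℝ 1 φ := hφ.of_le (by exact_mod_cast le_top)
  have hc : Continuous fun s => (L : ℝ) * ‖fderiv ℝ φ (γ s)‖ :=
    continuous_const.mul (((hφ1.continuous_fderiv one_ne_zero).comp hγ.continuous).norm)
  have h1 := sub_le_integral_path hφ1 hγ hab
  have h2 := sub_le_integral_path hφ1.neg hγ hab
  have h2' : φ (γ a) - φ (γ b) ≤ ∫ s in a..b, L * ‖fderiv ℝ φ (γ s)‖ := by
    simp only [fderiv_fun_neg, norm_neg] at h2
    linarith
  have h3 : |φ (γ b) - φ (γ a)| ≤ ∫ s in a..b, L * ‖fderiv ℝ φ (γ s)‖ :=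
    abs_le.2 ⟨by linarith, h1⟩
  rw [← Real.norm_eq_abs] at h3
  rw [← ofReal_norm]
  refine (ENNReal.ofReal_le_ofReal h3).trans (le_of_eq ?_)
  rw [intervalIntegral.integral_of_le hab, ofReal_integral_eq_lintegral_ofReal
    (hc.integrableOn_Ioc) (Eventually.of_forall fun s => by positivity),
    ← lintegral_const_mul' _ _ ENNReal.coe_ne_top]
  refine lintegral_congr fun s => ?_
  rw [ENNReal.ofReal_mul L.coe_nonneg, ← norm_gradient, ofReal_norm, ENNReal.ofReal_coe_nnreal]

/-! ### Cauchy–Schwarz, subsequences, and distortion of volume -/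

/-- Cauchy–Schwarz for lower integrals. -/
lemma sq_lintegral_mul_le {α : Type*} [MeasurableSpace α] {μ : Measure α} {f g : α → ℝ≥0∞}
    (hf : AEMeasurable f μ) (hg : AEMeasurable g μ) :
    (∫⁻ x, f x * g x ∂μ) ^ 2 ≤ (∫⁻ x, f x ^ 2 ∂μ) * ∫⁻ x, g x ^ 2 ∂μ := by
  have h := ENNReal.lintegral_mul_le_Lp_mul_Lq μ Real.HolderConjugate.two_two hf hg
  simp only [Pi.mul_apply, ENNReal.rpow_two] at h
  calc _ ≤ ((∫⁻ x, f x ^ 2 ∂μ) ^ (1 / 2 : ℝ) * (∫⁻ x, g x ^ 2 ∂μ) ^ (1 / 2 : ℝ)) ^ 2 := by gcongr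
    _ = _ := by
      rw [mul_pow, ← ENNReal.rpow_two, ← ENNReal.rpow_two, ← ENNReal.rpow_mul, ← ENNReal.rpow_mul]
      norm_num

lemma sq_lintegral_Ioc_le {f : ℝ → ℝ≥0∞} (hf : Measurable f) (T : ℝ) :
    (∫⁻ s in Ioc 0 T, f s) ^ 2 ≤ ENNReal.ofReal T * ∫⁻ s in Ioc 0 T, f s ^ 2 := by
  have h := sq_lintegral_mul_le (μ := volume.restrict (Ioc 0 T)) (f := fun _ => 1)
    aemeasurable_const hf.aemeasurable
  simpa using h

/-- Along a subsequence whose integrals are at most `2⁻ᵏ`, the sum of the functions is integrable,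
hence finite almost everywhere, and its terms tend to zero. -/
lemma exists_subseq_ae_tendsto_zero {α : Type*} [MeasurableSpace α] {μ : Measure α}
    {a : ℕ → α → ℝ≥0∞} (ha : ∀ n, AEMeasurable (a n) μ)
    (h : Tendsto (fun n => ∫⁻ x, a n x ∂μ) atTop (𝓝 0)) :
    ∃ ns : ℕ → ℕ, StrictMono ns ∧ ∀ᵐ x ∂μ, Tendsto (fun k => a (ns k) x) atTop (𝓝 0) := by
  have h1 : ∀ k : ℕ, ∀ᶠ n in atTop, ∫⁻ x, a n x ∂μ ≤ (2⁻¹ : ℝ≥0∞) ^ k := fun k =>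
    h.eventually (ge_mem_nhds (ENNReal.pow_pos (by simp) k))
  obtain ⟨ns, hns, hle⟩ := extraction_forall_of_eventually h1
  refine ⟨ns, hns, ?_⟩
  have h2 : ∫⁻ x, ∑' k, a (ns k) x ∂μ ≠ ⊤ := by
    rw [lintegral_tsum fun k => ha _]
    refine ne_top_of_le_ne_top ?_ (ENNReal.tsum_le_tsum hle)
    rw [ENNReal.tsum_geometric]
    simp
  filter_upwards [ae_lt_top' (AEMeasurable.tsum fun k => ha _) h2] with x hx
  exact ENNReal.tendsto_atTop_zero_of_tsum_ne_top hx.ne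

/-- Volume is a multiple of the three-dimensional Hausdorff measure, which an `L`-Lipschitz map
enlarges by at most `L ^ 3`. -/
lemma volume_image_le {R : E3 → E3} {L : ℝ≥0} (hR : LipschitzWith L R) (A : Set E3) :
    volume (R '' A) ≤ ((L ^ 3 : ℝ≥0) : ℝ≥0∞) * volume A := by
  have : (Measure.hausdorffMeasure 3 : Measure E3).IsAddHaarMeasure := by
    simpa using isAddHaarMeasure_hausdorffMeasure (E := E3)
  rw [Measure.isAddLeftInvariant_eq_smul (volume : Measure E3) (Measure.hausdorffMeasure 3)]
  have h := hR.hausdorffMeasure_image_le (d := 3) (by norm_num) A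
  simp only [Measure.smul_apply, ENNReal.smul_def, smul_eq_mul]
  have e : ((L : ℝ≥0∞) ^ (3 : ℝ)) = ((L ^ 3 : ℝ≥0) : ℝ≥0∞) := by norm_cast
  rw [e] at h
  rw [mul_left_comm]
  gcongr

/-- A map `P` whose fibres are controlled by a Lipschitz map distorts lower integrals boundedly. -/
lemma lintegral_comp_le {P R : E3 → E3} {L : ℝ≥0} (hP : Measurable P) (hR : LipschitzWith L R)
    (hPR : ∀ x, P x = x ∨ x = R (P x)) {F : E3 → ℝ≥0∞} (hF : Measurable F) :
    ∫⁻ x, F (P x) ≤ ((1 + L ^ 3 : ℝ≥0) : ℝ≥0∞) * ∫⁻ x, F x := by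
  have h : Measure.map P volume ≤ (1 + L ^ 3 : ℝ≥0) • (volume : Measure E3) := by
    refine Measure.le_iff.2 fun A hA => ?_
    rw [Measure.map_apply hP hA]
    have hsub : P ⁻¹' A ⊆ A ∪ R '' A := by
      intro x hx
      rcases hPR x with h | h
      · left; rwa [← h]
      · exact Or.inr ⟨P x, hx, h.symm⟩
    calc volume (P ⁻¹' A) ≤ volume A + volume (R '' A) :=
          (measure_mono hsub).trans (measure_union_le _ _)
      _ ≤ volume A + ((L ^ 3 : ℝ≥0) : ℝ≥0∞) * volume A := by gcongr; exact volume_image_le hR A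
      _ = _ := by
        simp only [Measure.smul_apply, ENNReal.smul_def, smul_eq_mul, ENNReal.coe_add,
          ENNReal.coe_one]
        ring
  rw [← lintegral_map hF hP]
  refine (lintegral_mono' h le_rfl).trans (le_of_eq ?_)
  rw [lintegral_smul_measure]
  rfl

/-! ### Hardy's inequality on parallel lines -/

lemma lintegral_rpow_sub_le {T : ℝ} (hT : 0 < T) :
    ∫⁻ s in Ioo 0 T, ENNReal.ofReal ((T - s) ^ (-(1 / 2) : ℝ)) ≤
      ENNReal.ofReal (2 * T ^ (1 / 2 : ℝ)) := by
  have hi : IntervalIntegrable (fun s : ℝ => (T - s) ^ (-(1 / 2) : ℝ)) volume 0 T := by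
    have := (intervalIntegral.intervalIntegrable_rpow' (a := 0) (b := T)
      (r := -(1 / 2)) (by norm_num)).comp_sub_left T
    simpa using this.symm
  have hv : ∫ s in (0 : ℝ)..T, (T - s) ^ (-(1 / 2) : ℝ) = 2 * T ^ (1 / 2 : ℝ) := by
    rw [intervalIntegral.integral_comp_sub_left (fun s : ℝ => s ^ (-(1 / 2) : ℝ)) T, sub_self,
      sub_zero, integral_rpow (Or.inl (by norm_num))]
    norm_num
    ring
  rw [← hv, intervalIntegral.integral_of_le hT.le, ofReal_integral_eq_lintegral_ofReal hi.1]
  · exact lintegral_mono_set Ioo_subset_Ioc_self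
  · filter_upwards [ae_restrict_mem measurableSet_Ioc] with s hs
    exact Real.rpow_nonneg (sub_nonneg.2 hs.2) _

lemma lintegral_rpow_add_le {a : ℝ} (ha : 0 < a) :
    ∫⁻ s in Ioi 0, ENNReal.ofReal ((a + s) ^ (-(3 / 2) : ℝ)) ≤
      ENNReal.ofReal (2 * a ^ (-(1 / 2) : ℝ)) := by
  have hi := integrableOn_Ioi_rpow_of_lt (a := -(3 / 2)) (by norm_num) ha
  have hv : ∫ s in Ioi a, s ^ (-(3 / 2) : ℝ) = 2 * a ^ (-(1 / 2) : ℝ) := by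
    rw [integral_Ioi_rpow_of_lt (by norm_num) ha]
    norm_num
    ring
  rw [← hv, ofReal_integral_eq_lintegral_ofReal hi, ← lintegral_indicator measurableSet_Ioi,
    ← lintegral_indicator measurableSet_Ioi,
    ← lintegral_add_left_eq_self ((Ioi a).indicator _) a]
  · refine lintegral_mono fun s => ?_
    by_cases h : 0 < s
    · rw [indicator_of_mem (mem_Ioi.2 h), indicator_of_mem (by simpa using h)]
    · rw [indicator_of_notMem (by simpa using h)]; exact zero_le
  · filter_upwards [ae_restrict_mem measurableSet_Ioi] with s hs
    exact Real.rpow_nonneg (ha.le.trans (le_of_lt hs)) _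

/-- Cauchy–Schwarz with the weights `(T - s) ^ (±1/4)`: the factor without `F` integrates to `2 * T
^ (1/2)`. The remaining weight depends on `s` so that a later integration over starting points
converges. -/
lemma sq_lintegral_div_le {F : ℝ → ℝ≥0∞} (hF : Measurable F) {T : ℝ} (hT : 0 < T) :
    ((∫⁻ s in Ioo 0 T, F s) / ENNReal.ofReal T) ^ 2 ≤
      ∫⁻ s in Ioo 0 T, F s ^ 2 *
        ENNReal.ofReal (2 * T ^ (-(3 / 2) : ℝ) * (T - s) ^ (1 / 2 : ℝ)) := by
  have hpow : ∀ r : ℝ, Measurable fun s : ℝ => ENNReal.ofReal ((T - s) ^ r) := fun r =>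
    ((measurable_const.sub measurable_id).pow_const r).ennreal_ofReal
  have h1 : ∫⁻ s in Ioo 0 T, F s = ∫⁻ s in Ioo 0 T,
      (F s * ENNReal.ofReal ((T - s) ^ (1 / 4 : ℝ))) *
        ENNReal.ofReal ((T - s) ^ (-(1 / 4) : ℝ)) := by
    refine setLIntegral_congr_fun measurableSet_Ioo fun s hs => ?_
    have hp : 0 < T - s := sub_pos.2 hs.2
    rw [mul_assoc, ← ENNReal.ofReal_mul (by positivity), ← Real.rpow_add hp]
    norm_num
  have h2 := sq_lintegral_mul_le (μ := volume.restrict (Ioo 0 T))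
    (f := fun s => F s * ENNReal.ofReal ((T - s) ^ (1 / 4 : ℝ)))
    (g := fun s => ENNReal.ofReal ((T - s) ^ (-(1 / 4) : ℝ)))
    (hF.mul (hpow _)).aemeasurable (hpow _).aemeasurable
  have h3 : ∫⁻ s in Ioo 0 T, ENNReal.ofReal ((T - s) ^ (-(1 / 4) : ℝ)) ^ 2 ≤
      ENNReal.ofReal (2 * T ^ (1 / 2 : ℝ)) := by
    refine le_trans (le_of_eq ?_) (lintegral_rpow_sub_le hT)
    refine setLIntegral_congr_fun measurableSet_Ioo fun s hs => ?_
    have hp : 0 < T - s := sub_pos.2 hs.2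
    rw [← ENNReal.ofReal_pow (by positivity), ← Real.rpow_mul_natCast hp.le]
    norm_num
  have hm : Measurable fun s => (F s * ENNReal.ofReal ((T - s) ^ (1 / 4 : ℝ))) ^ 2 :=
    (hF.mul (hpow _)).pow_const 2
  rw [div_eq_mul_inv, mul_pow, h1]
  have hT2 : (ENNReal.ofReal T)⁻¹ ^ 2 = ENNReal.ofReal (T ^ (-2 : ℝ)) := by
    rw [← ENNReal.ofReal_inv_of_pos hT, ← ENNReal.ofReal_pow (by positivity), Real.rpow_neg hT.le]
    norm_num
  calc _ ≤ ((∫⁻ s in Ioo 0 T, (F s * ENNReal.ofReal ((T - s) ^ (1 / 4 : ℝ))) ^ 2) *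
        ENNReal.ofReal (2 * T ^ (1 / 2 : ℝ))) * ENNReal.ofReal (T ^ (-2 : ℝ)) := by
        rw [hT2]
        gcongr
        exact h2.trans (by gcongr)
    _ = _ := by
        rw [mul_assoc, ← ENNReal.ofReal_mul (by positivity), ← lintegral_mul_const _
          hm]
        refine setLIntegral_congr_fun measurableSet_Ioo fun s hs => ?_
        have hp : 0 < T - s := sub_pos.2 hs.2
        rw [mul_pow, mul_assoc, ← ENNReal.ofReal_pow (by positivity),
          ← ENNReal.ofReal_mul (by positivity), ← Real.rpow_mul_natCast hp.le]
        congr 2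
        have : T ^ (-(3 / 2) : ℝ) = T ^ (1 / 2 : ℝ) * T ^ (-2 : ℝ) := by
          rw [← Real.rpow_add hT]; norm_num
        rw [this]
        norm_num
        ring

/-- Hardy's inequality in the direction `f`. -/
lemma hardy_directional {τ : E3 → ℝ} (hτ : Measurable τ) {f : E3}
    (hs : ∀ x (s : ℝ), τ (x + s • f) = τ x - s) {F : E3 → ℝ≥0∞} (hF : Measurable F) :
    ∫⁻ x in {x | 0 < τ x}, ((∫⁻ s in Ioo 0 (τ x), F (x + s • f)) / ENNReal.ofReal (τ x)) ^ 2 ≤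
      4 * ∫⁻ x, F x ^ 2 := by
  -- The bound of `sq_lintegral_div_le` in terms of the running point `y = x + s • f`, where `T - s
  -- = τ y` and `T = τ y + s`. After translating in `x`, only an integral in `s` with `y` fixed
  -- remains.
  let k : E3 → ℝ → ℝ≥0∞ := fun y s => {z : E3 × ℝ | 0 < z.2 ∧ 0 < τ z.1}.indicator
    (fun z => F z.1 ^ 2 *
      ENNReal.ofReal (2 * (τ z.1 + z.2) ^ (-(3 / 2) : ℝ) * (τ z.1) ^ (1 / 2 : ℝ))) (y, s)
  have hset : MeasurableSet {z : E3 × ℝ | 0 < z.2 ∧ 0 < τ z.1} :=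
    (measurableSet_lt measurable_const measurable_snd).inter
      (measurableSet_lt measurable_const (hτ.comp measurable_fst))
  have hk : Measurable (Function.uncurry k) := by
    refine Measurable.indicator ?_ hset
    have h1 : Measurable fun z : E3 × ℝ => τ z.1 := hτ.comp measurable_fst
    exact ((hF.comp measurable_fst).pow_const 2).mul
      ((((h1.add measurable_snd).pow_const _).const_mul 2).mul (h1.pow_const _)).ennreal_ofReal
  have hshift : Measurable fun z : E3 × ℝ => (z.1 + z.2 • f, z.2) :=
    (measurable_fst.add (measurable_snd.smul_const f)).prodMk measurable_snd
  have hm : MeasurableSet {x | 0 < τ x} := measurableSet_lt measurable_const hτ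
  calc _ ≤ ∫⁻ x, ∫⁻ s, k (x + s • f) s := by
        rw [← lintegral_indicator hm]
        refine lintegral_mono fun x => ?_
        by_cases hx : 0 < τ x
        · rw [indicator_of_mem (show x ∈ {x | 0 < τ x} from hx)]
          refine (sq_lintegral_div_le (F := fun s => F (x + s • f))
            (hF.comp (measurable_const.add (measurable_id.smul_const f))) hx).trans ?_
          rw [← lintegral_indicator measurableSet_Ioo]
          refine lintegral_mono fun s => ?_
          by_cases h : s ∈ Ioo 0 (τ x)
          · rw [indicator_of_mem h]
            simp only [k]
            rw [indicator_of_mem (by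
              refine ⟨h.1, ?_⟩
              simp only [hs]; exact sub_pos.2 h.2)]
            simp only [hs, sub_add_cancel]
            exact le_rfl
          · rw [indicator_of_notMem h]; exact zero_le
        · rw [indicator_of_notMem (by simpa using hx)]; exact zero_le
    _ = ∫⁻ s, ∫⁻ x, k (x + s • f) s :=
        lintegral_lintegral_swap (hk.comp hshift).aemeasurable
    _ = ∫⁻ s, ∫⁻ y, k y s := by
        refine lintegral_congr fun s => ?_
        exact lintegral_add_right_eq_self (fun y => k y s) (s • f)
    _ = ∫⁻ y, ∫⁻ s, k y s := (lintegral_lintegral_swap hk.aemeasurable).symm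
    _ ≤ ∫⁻ y, 4 * F y ^ 2 := by
        refine lintegral_mono fun y => ?_
        by_cases hy : 0 < τ y
        · have e : ∀ s, k y s = F y ^ 2 * ENNReal.ofReal (2 * (τ y) ^ (1 / 2 : ℝ)) *
              (Ioi (0 : ℝ)).indicator
                (fun s => ENNReal.ofReal ((τ y + s) ^ (-(3 / 2) : ℝ))) s := by
            intro s
            simp only [k]
            by_cases h : 0 < s
            · rw [indicator_of_mem (by exact ⟨h, hy⟩), indicator_of_mem (mem_Ioi.2 h),
                mul_assoc (F y ^ 2), ← ENNReal.ofReal_mul (by positivity)]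
              congr 2
              ring
            · rw [indicator_of_notMem (by simp [h]), indicator_of_notMem (by simpa using h),
                mul_zero]
          simp_rw [e]
          have hmeas : Measurable fun s : ℝ => ENNReal.ofReal ((τ y + s) ^ (-(3 / 2) : ℝ)) :=
            ((measurable_const.add measurable_id).pow_const _).ennreal_ofReal
          rw [lintegral_const_mul _ (hmeas.indicator measurableSet_Ioi),
            lintegral_indicator measurableSet_Ioi]
          calc _ ≤ F y ^ 2 * ENNReal.ofReal (2 * (τ y) ^ (1 / 2 : ℝ)) *
                ENNReal.ofReal (2 * (τ y) ^ (-(1 / 2) : ℝ)) := by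
                gcongr; exact lintegral_rpow_add_le hy
            _ = _ := by
                rw [mul_assoc, ← ENNReal.ofReal_mul (by positivity), mul_comm]
                congr 1
                have : (τ y) ^ (1 / 2 : ℝ) * (τ y) ^ (-(1 / 2) : ℝ) = 1 := by
                  rw [← Real.rpow_add hy]; norm_num
                have e4 : 2 * (τ y) ^ (1 / 2 : ℝ) * (2 * (τ y) ^ (-(1 / 2) : ℝ)) = 4 := by
                  linear_combination 4 * this
                rw [e4]; norm_num
        · have e : ∀ s, k y s = 0 := fun s => indicator_of_notMem (by simp [hy]) _
          simp [e]
    _ = _ := lintegral_const_mul _ (hF.pow_const 2)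

/-! ### Charts and the geometry of Lipschitz domains -/

/-- Local description of the set `U` in the open set `V` by a Lipschitz function `τ` which decreases
with unit speed in the direction `f`: in `V`, the set `U` is given by `τ < 0`. -/
structure IsChart (U V : Set E3) (τ : E3 → ℝ) (M : ℝ≥0) (f : E3) : Prop where
  lipschitz : LipschitzWith M τ
  norm_dir : ‖f‖ = 1
  shift : ∀ x (s : ℝ), τ (x + s • f) = τ x - s
  isOpen : IsOpen V
  mem_iff : ∀ x ∈ V, (x ∈ U ↔ τ x < 0)
  null_cylinder : ∀ N : Set E3, Measure.hausdorffMeasure 2 N = 0 →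
    volume {x | ∃ s : ℝ, x + s • f ∈ N} = 0

/-- The projection along the cylinder direction is Lipschitz, so it sends `N` to a null set of the
plane. The cylinder lies in the preimage of that null set. -/
lemma volume_cylinder_eq_zero {N : Set E3} (hN : Measure.hausdorffMeasure 2 N = 0)
    (e : E3 ≃ₗᵢ[ℝ] E3) :
    volume {x | ∃ s : ℝ, x + s • e.symm (EuclideanSpace.single 2 1) ∈ N} = 0 := by
  let π : E3 → Fin 2 → ℝ := fun x j => e x (Fin.castSucc j)
  have hπ : LipschitzWith 1 π := by
    refine LipschitzWith.of_dist_le_mul fun x y => ?_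
    rw [NNReal.coe_one, one_mul, dist_pi_le_iff dist_nonneg]
    intro j
    rw [← e.dist_map x y, dist_eq_norm, dist_eq_norm]
    exact PiLp.norm_apply_le (e x - e y) (Fin.castSucc j)
  have h0 : volume (π '' N) = 0 := by
    rw [← hausdorffMeasure_pi_real]
    have := hπ.hausdorffMeasure_image_le (d := 2) (by norm_num) N
    rw [hN, mul_zero] at this
    simpa using this
  have hmp : Measure.QuasiMeasurePreserving π := by
    have h1 := (Measure.quasiMeasurePreserving_snd (μ := (volume : Measure ℝ))
      (ν := (volume : Measure (Fin 2 → ℝ)))).comp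
      ((volume_preserving_piFinSuccAbove (fun _ : Fin 3 => ℝ) (Fin.last 2)).comp
        ((PiLp.volume_preserving_ofLp (Fin 3)).comp
          e.measurePreserving)).quasiMeasurePreserving
    have e1 : π = Prod.snd ∘ (MeasurableEquiv.piFinSuccAbove (fun _ : Fin 3 => ℝ) (Fin.last 2)) ∘
        WithLp.ofLp ∘ e := by
      funext x j
      fin_cases j <;> rfl
    rw [e1]
    exact h1
  refine measure_mono_null ?_ (hmp.preimage_null h0)
  rintro x ⟨s, hs⟩
  refine ⟨_, hs, ?_⟩
  ext j
  have : (Fin.castSucc j) ≠ (2 : Fin 3) := by fin_cases j <;> decide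
  simp [π, this]

lemma IsLipschitzDomain.exists_chart {U : Set E3} (hU : IsLipschitzDomain U) {p : E3}
    (hp : p ∈ frontier U) : ∃ V τ M f, IsChart U V τ M f ∧ p ∈ V := by
  obtain ⟨e, ψ, K, V, hψ, hV, hpV, hiff⟩ := hU.graph p hp
  refine ⟨V, fun x => ψ !₂[e x 0, e x 1] - e x 2, K + 1,
    e.symm (EuclideanSpace.single 2 1), ⟨?_, by simp, ?_, hV, ?_, ?_⟩, hpV⟩
  · refine LipschitzWith.of_dist_le_mul fun x y => ?_
    have h1 := hψ.dist_le_mul !₂[e x 0, e x 1] !₂[e y 0, e y 1]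
    have h2 : dist !₂[e x 0, e x 1] !₂[e y 0, e y 1] ≤ dist x y := by
      rw [← e.dist_map x y, EuclideanSpace.dist_eq, EuclideanSpace.dist_eq]
      apply Real.sqrt_le_sqrt
      simp only [Fin.sum_univ_two, Fin.sum_univ_three]
      simp only [Matrix.cons_val_zero, Matrix.cons_val_one]
      have := sq_nonneg (dist (e x 2) (e y 2))
      linarith
    have h3 : |e x 2 - e y 2| ≤ dist x y := by
      rw [← e.dist_map x y, dist_eq_norm]
      exact PiLp.norm_apply_le (e x - e y) 2
    rw [Real.dist_eq] at h1 ⊢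
    calc _ = |(ψ !₂[e x 0, e x 1] - ψ !₂[e y 0, e y 1]) - (e x 2 - e y 2)| := by ring_nf
      _ ≤ |ψ !₂[e x 0, e x 1] - ψ !₂[e y 0, e y 1]| + |e x 2 - e y 2| := abs_sub _ _
      _ ≤ K * dist x y + dist x y := by
        refine add_le_add (h1.trans ?_) h3
        gcongr
      _ = _ := by push_cast; ring
  · intro x s
    simp
    ring
  · intro x hx
    rw [hiff x hx, sub_neg]
  · exact fun N hN => volume_cylinder_eq_zero hN e

namespace IsChart

variable {U V : Set E3} {τ : E3 → ℝ} {M : ℝ≥0} {f : E3}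

lemma tendsto_shift (f x : E3) : Tendsto (fun s : ℝ => x + s • f) (𝓝[>] 0) (𝓝 x) := by
  have : Continuous fun s : ℝ => x + s • f := by fun_prop
  simpa using (this.tendsto 0).mono_left nhdsWithin_le_nhds

lemma mem_closure_iff (h : IsChart U V τ M f) {x : E3} (hx : x ∈ V) :
    x ∈ closure U ↔ τ x ≤ 0 := by
  constructor
  · intro hc
    by_contra! hlt
    obtain ⟨y, ⟨hyV, hy⟩, hyU⟩ := mem_closure_iff_nhds.1 hc _
      (inter_mem (h.isOpen.mem_nhds hx) (h.lipschitz.continuous.continuousAt (lt_mem_nhds hlt)))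
    exact lt_asymm hy ((h.mem_iff y hyV).1 hyU)
  · intro hle
    refine mem_closure_of_tendsto (tendsto_shift f x) ?_
    filter_upwards [(tendsto_shift f x) (h.isOpen.mem_nhds hx), self_mem_nhdsWithin] with s hs hs0
    rw [h.mem_iff _ hs, h.shift]
    have : (0 : ℝ) < s := hs0
    linarith

/-- Moving against `f` increases `τ`, so arbitrarily close to a point with `τ ≥ 0` there are points
with `τ > 0`, which lie outside `closure U`. -/
lemma notMem_interior_closure (h : IsChart U V τ M f) {x : E3} (hx : x ∈ V) (hxU : x ∉ U) :
    x ∉ interior (closure U) := by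
  intro hi
  have ht : Tendsto (fun s : ℝ => x + s • (-f)) (𝓝[>] 0) (𝓝 x) := tendsto_shift (-f) x
  obtain ⟨s, ⟨hsV, hsi⟩, hs0⟩ := ((ht.eventually (inter_mem (h.isOpen.mem_nhds hx)
    (isOpen_interior.mem_nhds hi))).and self_mem_nhdsWithin).exists
  have h1 := (h.mem_closure_iff hsV).1 (interior_subset hsi)
  have h2 := (h.mem_iff x hx).not.1 hxU
  have h3 := h.shift x (-s)
  rw [neg_smul, ← smul_neg] at h3
  have : (0 : ℝ) < s := hs0
  linarith

end IsChart

lemma IsLipschitzDomain.interior_closure {U : Set E3} (hU : IsLipschitzDomain U) :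
    interior (closure U) = U := by
  refine Subset.antisymm (fun x hx => ?_) (interior_maximal subset_closure hU.isOpen)
  by_contra hxU
  have hfr : x ∈ frontier U := by
    rw [hU.isOpen.frontier_eq]
    exact ⟨interior_subset hx, hxU⟩
  obtain ⟨V, τ, M, f, hc, hxV⟩ := hU.exists_chart hfr
  exact hc.notMem_interior_closure hxV hxU hx

lemma IsLipschitzPolyhedron.isCompact_closure {U : Set E3} (hU : IsLipschitzPolyhedron U) :
    IsCompact (closure U) := by
  obtain ⟨T, hT⟩ := hU.polytopes
  rw [hT]
  exact T.isCompact_biUnion fun t _ => t.finite_toSet.isCompact_convexHull ℝ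

/-- A boundary point lies in some polytope but not in its interior, since `interior (closure U) =
U`. Boundaries of convex sets are null. -/
lemma IsLipschitzPolyhedron.volume_frontier {U : Set E3} (hU : IsLipschitzPolyhedron U) :
    volume (frontier U) = 0 := by
  obtain ⟨T, hT⟩ := hU.polytopes
  have hsub : frontier U ⊆ ⋃ t ∈ T, frontier (convexHull ℝ (t : Set E3)) := by
    intro x hx
    rw [hU.isOpen.frontier_eq, hT] at hx
    obtain ⟨hx1, hx2⟩ := hx
    simp only [mem_iUnion] at hx1 ⊢
    obtain ⟨t, ht, hxt⟩ := hx1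
    refine ⟨t, ht, subset_closure hxt, fun hi => hx2 ?_⟩
    rw [← hU.toIsLipschitzDomain.interior_closure, hT]
    exact interior_mono (subset_biUnion_of_mem (u := fun t : Finset E3 =>
      convexHull ℝ (t : Set E3)) ht) hi
  exact measure_mono_null hsub ((measure_biUnion_null_iff T.countable_toSet).2
    fun t _ => (convex_convexHull ℝ _).addHaar_frontier volume)

/-! ### Vanishing traces and integration along retracted segments -/

lemma tendsto_zero_of_sq {a : ℕ → ℝ≥0∞} (h : Tendsto (fun n => a n ^ 2) atTop (𝓝 0)) :
    Tendsto a atTop (𝓝 0) := by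
  have := (ENNReal.continuous_rpow_const (y := (1 / 2 : ℝ))).tendsto 0 |>.comp h
  have e : ∀ n, (a n ^ 2) ^ (1 / 2 : ℝ) = a n := fun n => by
    rw [← ENNReal.rpow_two, ← ENNReal.rpow_mul]; norm_num
  simp only [Function.comp_def, e] at this
  simpa using this

lemma continuous_gradient {φ : E3 → ℝ} (hφ : ContDiff ℝ ∞ φ) : Continuous (gradient φ) :=
  (InnerProductSpace.toDual ℝ E3).symm.continuous.comp (hφ.continuous_fderiv (by simp))

/-- Squared `L²` bound for the integrals of `H ∘ P` along segments in the direction `f`. -/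
lemma lintegral_segment_le {P R : E3 → E3} {L : ℝ≥0} (hP : Measurable P) (hR : LipschitzWith L R)
    (hPR : ∀ x, P x = x ∨ x = R (P x)) {H : E3 → ℝ≥0∞} (hH : Measurable H) (f : E3) (T : ℝ) :
    ∫⁻ x, ∫⁻ s in Ioc 0 T, H (P (x + s • f)) ≤
      ENNReal.ofReal T * (((1 + L ^ 3 : ℝ≥0) : ℝ≥0∞) * ∫⁻ x, H x) := by
  have hshift : Measurable fun z : E3 × ℝ => P (z.1 + z.2 • f) :=
    hP.comp (measurable_fst.add (measurable_snd.smul_const f))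
  have hHs : Measurable (Function.uncurry fun (x : E3) (s : ℝ) => H (P (x + s • f))) :=
    hH.comp hshift
  rw [lintegral_lintegral_swap hHs.aemeasurable]
  calc _ = ∫⁻ s in Ioc 0 T, ∫⁻ x, H (P x) := by
        refine lintegral_congr fun s => ?_
        exact lintegral_add_right_eq_self (fun y => H (P y)) (s • f)
    _ ≤ ∫⁻ s in Ioc 0 T, (((1 + L ^ 3 : ℝ≥0) : ℝ≥0∞) * ∫⁻ x, H x) :=
        lintegral_mono fun s => lintegral_comp_le hP hR hPR hH
    _ = _ := by simp [mul_comm]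

/-- The path inequality holds for the smooth approximants of `u`, and passes to the limit along a
subsequence for almost every `x`. Three null sets are discarded: where the approximants fail to
converge to `u`, where the gradient errors along the segment fail to vanish, and where the path
could end at a point of `Γ` with a bad trace. -/
lemma MemH1Zero.ae_enorm_le {Ω Γ : Set E3} {u : E3 → ℝ} {g g' : E3 → E3}
    (hu : MemH1Zero Ω Γ u g) (hfr : volume (frontier Ω) = 0)
    (hΓm : MeasurableSet Γ) (hΓ : Γ ⊆ frontier Ω)
    (hg' : Measurable g') (hgg' : g =ᵐ[volume.restrict Ω] g')
    {P R : E3 → E3} {L : ℝ≥0} (hP : LipschitzWith L P) (hR : LipschitzWith L R)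
    (hPR : ∀ x, P x = x ∨ x = R (P x)) {τ : E3 → ℝ} {f : E3} (hf : ‖f‖ = 1)
    (hnull : ∀ N : Set E3, Measure.hausdorffMeasure 2 N = 0 →
      volume {x | ∃ s : ℝ, x + s • f ∈ N} = 0)
    {B : Set E3} (hB : MeasurableSet B) (hBΩ : B ⊆ Ω) {T : ℝ} (hT : ∀ x ∈ B, τ x ≤ T)
    (hpath : ∀ x ∈ B, P x = x ∧ ∃ s ∈ Icc 0 (τ x), P (x + s • f) ∈ Γ ∧
      ∀ s' ∈ Icc 0 s, P (x + s' • f) ∈ closure Ω) :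
    ∀ᵐ x ∂(volume.restrict B), ‖u x‖ₑ ≤ L * ∫⁻ s in Ioo 0 (τ x),
      (closure Ω).indicator (fun y => ‖g' y‖ₑ) (P (x + s • f)) := by
  obtain ⟨t, ⟨ht, φ, hφ, hφu, hφg, hφt⟩, ht0⟩ := hu.trace_zero
  have hPm : Measurable P := hP.continuous.measurable
  have hcm : MeasurableSet (closure Ω) := isClosed_closure.measurableSet
  have hcl : volume.restrict (closure Ω) = volume.restrict Ω := by
    refine Measure.restrict_congr_set ?_
    rw [closure_eq_self_union_frontier]
    exact union_ae_eq_left_of_ae_eq_empty (ae_eq_empty.2 hfr)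
  let H : ℕ → E3 → ℝ≥0∞ := fun n => (closure Ω).indicator fun y => ‖gradient (φ n) y - g' y‖ₑ
  have hHm : ∀ n, Measurable (H n) := fun n =>
    (((continuous_gradient (hφ n)).measurable.sub hg').enorm).indicator hcm
  let G : E3 → ℝ≥0∞ := (closure Ω).indicator fun y => ‖g' y‖ₑ
  have hH2 : Tendsto (fun n => ∫⁻ x, H n x ^ 2) atTop (𝓝 0) := by
    refine hφg.congr fun n => ?_
    have e : ∀ x, H n x ^ 2 =
        (closure Ω).indicator (fun y => ‖gradient (φ n) y - g' y‖ₑ ^ 2) x := fun x => by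
      by_cases h : x ∈ closure Ω <;> simp [H, h]
    simp_rw [e]
    rw [lintegral_indicator hcm, hcl]
    refine lintegral_congr_ae ?_
    filter_upwards [hgg'] with x hx
    rw [hx]
  -- The gradient error is integrated up to the fixed time `T`, which dominates all hitting times,
  -- so no measurability of the hitting time is needed.
  let K : ℕ → E3 → ℝ≥0∞ := fun n x => ∫⁻ s in Ioc 0 T, H n (P (x + s • f)) ^ 2
  have hshift : Measurable fun z : E3 × ℝ => P (z.1 + z.2 • f) :=
    hPm.comp (measurable_fst.add (measurable_snd.smul_const f))
  have hKm : ∀ n, Measurable (K n) := fun n =>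
    Measurable.lintegral_prod_right (((hHm n).comp hshift).pow_const 2)
  have hK : Tendsto (fun n => ∫⁻ x, K n x) atTop (𝓝 0) := by
    have h1 : Tendsto (fun n => ENNReal.ofReal T * (((1 + L ^ 3 : ℝ≥0) : ℝ≥0∞) *
        ∫⁻ x, H n x ^ 2)) atTop (𝓝 0) := by
      have := ENNReal.Tendsto.const_mul (a := ENNReal.ofReal T)
        (ENNReal.Tendsto.const_mul (a := ((1 + L ^ 3 : ℝ≥0) : ℝ≥0∞)) hH2
          (Or.inr ENNReal.coe_ne_top)) (Or.inr ENNReal.ofReal_ne_top)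
      simpa using this
    exact tendsto_of_tendsto_of_tendsto_of_le_of_le tendsto_const_nhds h1 (fun _ => zero_le)
      fun n => lintegral_segment_le hPm hR hPR ((hHm n).pow_const 2) f T
  obtain ⟨n1, hn1, ha1⟩ := exists_subseq_ae_tendsto_zero (fun n => (hKm n).aemeasurable) hK
  have hφm : ∀ n, Measurable (φ n) := fun n => (hφ n).continuous.measurable
  obtain ⟨n2, hn2, ha2⟩ := exists_subseq_ae_tendsto_zero (μ := volume.restrict Ω)
    (a := fun k x => ‖φ (n1 k) x - u x‖ₑ ^ 2)
    (fun k => (((hφm _).aemeasurable.sub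
      hu.hasH1Gradient.memLp.aestronglyMeasurable.aemeasurable).enorm).pow_const 2)
    (hφu.comp hn1.tendsto_atTop)
  obtain ⟨n3, hn3, ha3⟩ := exists_subseq_ae_tendsto_zero (μ := surfaceMeasure Ω)
    (a := fun k x => ‖φ (n1 (n2 k)) x - t x‖ₑ ^ 2)
    (fun k => (((hφm _).aemeasurable.sub ht.aestronglyMeasurable.aemeasurable).enorm).pow_const 2)
    (hφt.comp (hn1.comp hn2).tendsto_atTop)
  let m : ℕ → ℕ := fun k => n1 (n2 (n3 k))
  have hbad : Measure.hausdorffMeasure 2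
      {q | ¬ (q ∈ Γ → Tendsto (fun k => ‖φ (m k) q‖ₑ) atTop (𝓝 0))} = 0 := by
    rw [surfaceMeasure, ae_restrict_iff' isClosed_frontier.measurableSet] at ha3
    rw [surfaceMeasure, ae_restrict_iff' hΓm,
      ae_restrict_iff' isClosed_frontier.measurableSet] at ht0
    rw [← ae_iff]
    filter_upwards [ha3, ht0] with q h3 h0 hq
    have := tendsto_zero_of_sq (h3 (hΓ hq))
    simpa [h0 (hΓ hq) hq] using this
  set N := {q | ¬ (q ∈ Γ → Tendsto (fun k => ‖φ (m k) q‖ₑ) atTop (𝓝 0))} with hN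
  -- The reflection `R` carries surface-null sets to surface-null sets, so the bad set remains null
  -- when pulled back by `P`; its cylinder in direction `f` is then volume-null.
  have hPN : Measure.hausdorffMeasure 2 (P ⁻¹' N) = 0 := by
    have hsub : P ⁻¹' N ⊆ N ∪ R '' N := by
      intro x hx
      rcases hPR x with h | h
      · left; rwa [← h]
      · exact Or.inr ⟨P x, hx, h.symm⟩
    refine measure_mono_null hsub (measure_union_null hbad ?_)
    have := hR.hausdorffMeasure_image_le (d := 2) (by norm_num) N
    rw [hbad, mul_zero] at this
    simpa using this
  have hcyl := hnull _ hPN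
  have hcyl' : ∀ᵐ x : E3, ¬ ∃ s : ℝ, x + s • f ∈ P ⁻¹' N := by
    rw [ae_iff]; simpa using! hcyl
  filter_upwards [ae_restrict_of_ae ha1, ae_mono (Measure.restrict_mono hBΩ le_rfl) ha2,
    ae_restrict_of_ae hcyl', ae_restrict_mem hB] with x hx1 hx2 hx3 hxB
  obtain ⟨hPx, s, hs, hsΓ, hsΩ⟩ := hpath x hxB
  have hq : Tendsto (fun k => ‖φ (m k) (P (x + s • f))‖ₑ) atTop (𝓝 0) := by
    by_contra hcon
    exact hx3 ⟨s, fun h => hcon (h hsΓ)⟩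
  have hu0 : Tendsto (fun k => ‖φ (m k) x - u x‖ₑ) atTop (𝓝 0) :=
    tendsto_zero_of_sq (hx2.comp hn3.tendsto_atTop)
  have hI : Tendsto (fun k => ∫⁻ s in Ioc 0 T, H (m k) (P (x + s • f))) atTop (𝓝 0) := by
    refine tendsto_zero_of_sq ?_
    have h1 : Tendsto (fun k => ENNReal.ofReal T * K (m k) x) atTop (𝓝 0) := by
      have := ENNReal.Tendsto.const_mul (a := ENNReal.ofReal T)
        (hx1.comp (hn2.comp hn3).tendsto_atTop) (Or.inr ENNReal.ofReal_ne_top)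
      simpa using this
    exact tendsto_of_tendsto_of_tendsto_of_le_of_le tendsto_const_nhds h1 (fun _ => zero_le)
      fun k => sq_lintegral_Ioc_le ((hHm _).comp (hshift.comp measurable_prodMk_left)) T
  have hlim : Tendsto (fun k => ‖φ (m k) x - u x‖ₑ + (‖φ (m k) (P (x + s • f))‖ₑ +
      L * ((∫⁻ s in Ioc 0 T, H (m k) (P (x + s • f))) +
        ∫⁻ s in Ioo 0 (τ x), G (P (x + s • f))))) atTop
      (𝓝 (0 + (0 + L * (0 + ∫⁻ s in Ioo 0 (τ x), G (P (x + s • f)))))) :=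
    hu0.add (hq.add (ENNReal.Tendsto.const_mul (hI.add tendsto_const_nhds)
      (Or.inr ENNReal.coe_ne_top)))
  rw [zero_add, zero_add, zero_add] at hlim
  refine ge_of_tendsto' hlim fun k => ?_
  have hγ : LipschitzWith L fun s : ℝ => P (x + s • f) := by
    have h1 : LipschitzWith 1 fun s : ℝ => x + s • f := by
      refine LipschitzWith.of_dist_le_mul fun a b => ?_
      rw [dist_add_left, dist_eq_norm, ← sub_smul, norm_smul, hf, dist_eq_norm]
      simp
    simpa using! hP.comp h1
  have hv := enorm_sub_le_lintegral_path (hφ (m k)) hγ hs.1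
  rw [zero_smul, add_zero, hPx] at hv
  have hint : ∫⁻ r in Ioc 0 s, ‖gradient (φ (m k)) (P (x + r • f))‖ₑ ≤
      (∫⁻ s in Ioc 0 T, H (m k) (P (x + s • f))) + ∫⁻ s in Ioo 0 (τ x), G (P (x + s • f)) := by
    have hGH : ∫⁻ r in Ioc 0 s, ‖gradient (φ (m k)) (P (x + r • f))‖ₑ ≤
        ∫⁻ r in Ioc 0 s, (H (m k) (P (x + r • f)) + G (P (x + r • f))) := by
      refine setLIntegral_mono' measurableSet_Ioc fun r hr => ?_
      have hc := hsΩ r ⟨hr.1.le, hr.2⟩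
      simp only [H, G, indicator_of_mem hc]
      calc ‖gradient (φ (m k)) (P (x + r • f))‖ₑ
          = ‖(gradient (φ (m k)) (P (x + r • f)) - g' (P (x + r • f))) + g' (P (x + r • f))‖ₑ := by
            rw [sub_add_cancel]
        _ ≤ _ := enorm_add_le _ _
    refine hGH.trans ?_
    have hHk : Measurable fun r : ℝ => H (m k) (P (x + r • f)) :=
      (hHm _).comp (hshift.comp measurable_prodMk_left)
    rw [lintegral_add_left hHk]
    gcongr ?_ + ?_
    · exact lintegral_mono_set (Ioc_subset_Ioc_right (hs.2.trans (hT x hxB)))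
    · rw [setLIntegral_congr (Ioo_ae_eq_Ioc (a := (0 : ℝ)) (b := τ x))]
      exact lintegral_mono_set (Ioc_subset_Ioc_right hs.2)
  calc ‖u x‖ₑ = ‖-(φ (m k) x - u x) + (φ (m k) (P (x + s • f)) -
        (φ (m k) (P (x + s • f)) - φ (m k) x))‖ₑ := by congr 1; ring
    _ ≤ ‖φ (m k) x - u x‖ₑ + (‖φ (m k) (P (x + s • f))‖ₑ +
        ‖φ (m k) (P (x + s • f)) - φ (m k) x‖ₑ) := by
        refine (enorm_add_le _ _).trans ?_
        rw [enorm_neg]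
        gcongr
        exact enorm_sub_le
    _ ≤ _ := by
        gcongr
        exact hv.trans (by gcongr)

/-! ### Retraction onto the closure and first hitting times -/

/-- Near a point of its closure, a Lipschitz domain `D` admits a Lipschitz retraction `P` onto its
closure whose fibres are controlled by another Lipschitz map (the reflection at the boundary). -/
lemma IsLipschitzDomain.exists_retraction {D : Set E3} (hD : IsLipschitzDomain D) {p : E3}
    (hp : p ∈ closure D) : ∃ (P R : E3 → E3) (L : ℝ≥0), LipschitzWith L P ∧ LipschitzWith L R ∧
      (∀ x, P x = x ∨ x = R (P x)) ∧
      ∃ V ∈ 𝓝 p, ∀ x ∈ V, P x ∈ closure D ∧ (x ∈ closure D → P x = x) := by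
  by_cases hpD : p ∈ D
  · exact ⟨id, id, 1, LipschitzWith.id, LipschitzWith.id, fun x => Or.inl rfl, D,
      hD.isOpen.mem_nhds hpD, fun x hx => ⟨subset_closure hx, fun _ => rfl⟩⟩
  obtain ⟨V, σ, M, f, hc, hpV⟩ := hD.exists_chart (p := p) (by
    rw [hD.isOpen.frontier_eq]; exact ⟨hp, hpD⟩)
  have hmul : ∀ {a : E3 → ℝ}, LipschitzWith M a →
      LipschitzWith (1 + 2 * M) fun x => x + (2 * a x) • f := by
    intro a ha
    refine LipschitzWith.of_dist_le_mul fun x y => ?_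
    have h1 := ha.dist_le_mul x y
    rw [Real.dist_eq] at h1
    calc dist (x + (2 * a x) • f) (y + (2 * a y) • f)
        ≤ dist x y + dist ((2 * a x) • f) ((2 * a y) • f) := dist_add_add_le _ _ _ _
      _ = dist x y + 2 * |a x - a y| := by
          rw [dist_eq_norm ((2 * a x) • f), ← sub_smul, norm_smul, hc.norm_dir, ← mul_sub,
            norm_mul]
          simp
      _ ≤ dist x y + 2 * (M * dist x y) := by gcongr
      _ = _ := by push_cast; ring
  -- A shift by `2 * σ x` turns `σ x` into `-σ x`. `P` performs this reflection only where `σ > 0`,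
  -- and there the full reflection `x + (2 * σ x) • f` undoes it.
  have hP : LipschitzWith (1 + 2 * M) fun x => x + (2 * max (σ x) 0) • f :=
    hmul (hc.lipschitz.max_const 0)
  have hσp : σ p ≤ 0 := (hc.mem_closure_iff hpV).1 hp
  refine ⟨_, _, _, hP, hmul hc.lipschitz, fun x => ?_,
    V ∩ (fun x => x + (2 * max (σ x) 0) • f) ⁻¹' V,
    inter_mem (hc.isOpen.mem_nhds hpV)
      (hP.continuous.continuousAt (hc.isOpen.mem_nhds (by simpa [hσp] using hpV))), ?_⟩
  · rcases le_total (σ x) 0 with h | h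
    · left; simp [h]
    · right
      simp only [max_eq_left h, hc.shift]
      module
  · rintro x ⟨hx, hPx⟩
    refine ⟨(hc.mem_closure_iff hPx).2 ?_, fun hxD => ?_⟩
    · rw [hc.shift]
      rcases le_total (σ x) 0 with h | h
      · simp [h]
      · rw [max_eq_left h]; linarith
    · simp [(hc.mem_closure_iff hx).1 hxD]

/-- A continuous path in the union of two closed sets which ends in the first one has a first
time in it, and stays in the second one until then. -/
lemma exists_first_time {γ : ℝ → E3} (hγ : Continuous γ) {A B : Set E3} (hA : IsClosed A)
    (hB : IsClosed B) {T : ℝ} (hT : 0 ≤ T) (hAB : ∀ s ∈ Icc 0 T, γ s ∈ A ∪ B) (h0 : γ 0 ∈ B)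
    (hend : γ T ∈ A) : ∃ s ∈ Icc 0 T, γ s ∈ A ∩ B ∧ ∀ r ∈ Icc 0 s, γ r ∈ B := by
  have hcomp : IsCompact (Icc 0 T ∩ γ ⁻¹' A) := isCompact_Icc.inter_right (hA.preimage hγ)
  obtain ⟨s, ⟨hs, hsA⟩, hmin⟩ := hcomp.exists_isLeast ⟨T, ⟨hT, le_rfl⟩, hend⟩
  have hlt : ∀ r ∈ Ico 0 s, γ r ∈ B := fun r hr => by
    have hrT : r ∈ Icc 0 T := ⟨hr.1, hr.2.le.trans hs.2⟩
    refine (hAB r hrT).resolve_left fun hrA => ?_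
    exact absurd (hmin ⟨hrT, hrA⟩) (not_le.2 hr.2)
  have hsB : γ s ∈ B := by
    rcases hs.1.eq_or_lt with h | h
    · rwa [← h]
    · have : s ∈ closure (Ico 0 s) := by
        rw [closure_Ico h.ne]; exact ⟨h.le, le_rfl⟩
      exact closure_minimal (show Ico 0 s ⊆ γ ⁻¹' B from hlt) (hB.preimage hγ) this
  refine ⟨s, hs, ⟨hsA, hsB⟩, fun r hr => ?_⟩
  rcases hr.2.eq_or_lt with h | h
  · rwa [h]
  · exact hlt r ⟨hr.1, h⟩

/-! ### The local Hardy inequality at the Dirichlet part -/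

/-- The Hardy inequality holds in a neighbourhood of `p`, uniformly in `u`. -/
def HardyNear (Ω Γ : Set E3) (p : E3) : Prop :=
  ∃ r > 0, ∃ C : ℝ≥0, ∀ (u : E3 → ℝ) (g : E3 → E3), MemH1Zero Ω Γ u g →
    ∫⁻ x in Ω ∩ Metric.ball p r, (‖u x‖ₑ / Metric.infEDist x Γ) ^ 2 ≤ C * ∫⁻ x in Ω, ‖g x‖ₑ ^ 2

/-- The `L²` norm near `p` is bounded by the gradient, uniformly in `u`. -/
def PoincareNear (Ω Γ : Set E3) (p : E3) : Prop :=
  ∃ r > 0, ∃ C : ℝ≥0, ∀ (u : E3 → ℝ) (g : E3 → E3), MemH1Zero Ω Γ u g →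
    ∫⁻ x in Ω ∩ Metric.ball p r, ‖u x‖ₑ ^ 2 ≤ C * ∫⁻ x in Ω, ‖g x‖ₑ ^ 2

lemma hardyNear_of_attached {Ω Γ W D : Set E3} (hΩ : IsOpen Ω) (hfr : volume (frontier Ω) = 0)
    (hΓm : MeasurableSet Γ) (hΓ : Γ ⊆ frontier Ω) (hW : IsLipschitzDomain W)
    (hWΩ : W ∩ Ω = ∅) (hWΓ : closure W ∩ closure Ω ⊆ Γ) (hD : IsLipschitzDomain D)
    (hΩD : Ω ⊆ closure D) (hWD : W ⊆ closure D) {p : E3} (hpW : p ∈ closure W)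
    (hpΩ : p ∈ closure Ω) {N : Set E3} (hN : N ∈ 𝓝 p)
    (hND : closure D ∩ N ⊆ closure Ω ∪ closure W) (hNΓ : Γ ∩ N ⊆ closure W) :
    HardyNear Ω Γ p := by
  have hdisj : ∀ x ∈ Ω, x ∉ closure W := fun x hx hxW => by
    obtain ⟨y, hy1, hy2⟩ := mem_closure_iff_nhds.1 hxW _ (hΩ.mem_nhds hx)
    exact notMem_empty y (hWΩ ▸ ⟨hy2, hy1⟩)
  have hdisj' : ∀ x ∈ closure Ω, x ∉ W := fun x hx hxW => by
    obtain ⟨y, hy1, hy2⟩ := mem_closure_iff_nhds.1 hx _ (hW.isOpen.mem_nhds hxW)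
    exact notMem_empty y (hWΩ ▸ ⟨hy1, hy2⟩)
  have hWD' : closure W ⊆ closure D := closure_minimal hWD isClosed_closure
  obtain ⟨V, τ, M, f, hc, hpV⟩ := hW.exists_chart (p := p) (by
    rw [hW.isOpen.frontier_eq]; exact ⟨hpW, hdisj' p hpΩ⟩)
  obtain ⟨P, R, L, hP, hR, hPR, V', hV', hPV⟩ := hD.exists_retraction (hWD' hpW)
  have hPp : P p = p := (hPV p (mem_of_mem_nhds hV')).2 (hWD' hpW)
  have hnhds : V ∩ (V' ∩ (N ∩ P ⁻¹' N)) ∈ 𝓝 p := by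
    refine inter_mem (hc.isOpen.mem_nhds hpV) (inter_mem hV' (inter_mem hN ?_))
    exact hP.continuous.continuousAt (by rwa [hPp])
  obtain ⟨ρ, hρ, hball⟩ := Metric.mem_nhds_iff.1 hnhds
  have hzero : ∀ q ∈ closure W ∩ closure Ω, q ∈ V → τ q = 0 := fun q hq hqV =>
    le_antisymm ((hc.mem_closure_iff hqV).1 hq.1)
      (not_lt.1 ((hc.mem_iff q hqV).not.1 (hdisj' q hq.2)))
  have hτp : τ p = 0 := hzero p ⟨hpW, hpΩ⟩ hpV
  -- Hitting times on the `r`-ball are at most `M * r`, so segments stay within `(M + 1) * r` of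
  -- `p`. The other need is `2 * r ≤ ρ`, used to compare with nearby points of `Γ`.
  set r : ℝ := ρ / (M + 2) with hr_def
  have hM2 : (0 : ℝ) < M + 2 := by positivity
  have hr : 0 < r := by positivity
  have hrρ : (M + 2) * r = ρ := by rw [hr_def]; field_simp
  have hMr : 0 ≤ (M : ℝ) * r := by positivity
  have hτle : ∀ x ∈ Metric.ball p r, τ x ≤ M * r := fun x hx => by
    have h1 := hc.lipschitz.dist_le_mul x p
    rw [Real.dist_eq, hτp, sub_zero] at h1
    exact (le_abs_self _).trans (h1.trans (by gcongr; exact (Metric.mem_ball.1 hx).le))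
  have hsmall : Metric.ball p r ⊆ Metric.ball p ρ := Metric.ball_subset_ball (by nlinarith)
  have hpos : ∀ x ∈ Ω ∩ Metric.ball p r, 0 < τ x := fun x hx => by
    by_contra! hle
    exact hdisj x hx.1 ((hc.mem_closure_iff (hball (hsmall hx.2)).1).2 hle)
  have hseg : ∀ x ∈ Ω ∩ Metric.ball p r, ∀ s ∈ Icc 0 (τ x), x + s • f ∈ Metric.ball p ρ := by
    intro x hx s hs
    have h1 := Metric.mem_ball.1 hx.2
    have h2 : dist (x + s • f) x ≤ M * r := by
      rw [dist_eq_norm, add_sub_cancel_left, norm_smul, hc.norm_dir, mul_one, Real.norm_eq_abs,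
        abs_of_nonneg hs.1]
      exact hs.2.trans (hτle x hx.2)
    have := dist_triangle (x + s • f) x p
    rw [Metric.mem_ball]
    nlinarith
  have hdist : ∀ x ∈ Ω ∩ Metric.ball p r, ENNReal.ofReal (τ x) ≤ M * Metric.infEDist x Γ := by
    intro x hx
    have hM0 : (M : ℝ≥0∞) ≠ 0 := by
      intro h0
      have h1 := hτle x hx.2
      have h2 := hpos x hx
      rw [ENNReal.coe_eq_zero] at h0
      rw [h0] at h1
      simp only [NNReal.coe_zero, zero_mul] at h1
      linarith
    rw [mul_comm, ← ENNReal.div_le_iff_le_mul (Or.inl hM0) (Or.inl ENNReal.coe_ne_top),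
      Metric.le_infEDist]
    intro q hq
    rw [ENNReal.div_le_iff_le_mul (Or.inl hM0) (Or.inl ENNReal.coe_ne_top), edist_dist,
      ← ENNReal.ofReal_coe_nnreal, ← ENNReal.ofReal_mul dist_nonneg]
    refine ENNReal.ofReal_le_ofReal ?_
    -- A point `q ∈ Γ` near `x` lies in `closure W`, where `τ q = 0`, and the Lipschitz bound
    -- applies; a distant one is harmless because `τ x ≤ M * r`.
    rcases lt_or_ge (dist x q) r with hlt | hge
    · have hqb : q ∈ Metric.ball p ρ := by
        have h1 := Metric.mem_ball.1 hx.2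
        have h2 := dist_triangle_left q p x
        rw [Metric.mem_ball]
        nlinarith
      have hqz := hzero q ⟨hNΓ ⟨hq, (hball hqb).2.2.1⟩, frontier_subset_closure (hΓ hq)⟩
        (hball hqb).1
      have h1 := hc.lipschitz.dist_le_mul x q
      rw [Real.dist_eq, hqz, sub_zero] at h1
      linarith [le_abs_self (τ x)]
    · have h1 := hτle x hx.2
      have h2 : (M : ℝ) * r ≤ M * dist x q := by gcongr
      linarith
  have hpath : ∀ x ∈ Ω ∩ Metric.ball p r, P x = x ∧ ∃ s ∈ Icc 0 (τ x), P (x + s • f) ∈ Γ ∧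
      ∀ s' ∈ Icc 0 s, P (x + s' • f) ∈ closure Ω := by
    intro x hx
    have hPx : P x = x := (hPV x (hball (hsmall hx.2)).2.1).2 (hΩD hx.1)
    refine ⟨hPx, ?_⟩
    have hendb := hball (hseg x hx (τ x) ⟨(hpos x hx).le, le_rfl⟩)
    have hendW : x + τ x • f ∈ closure W := by
      rw [hc.mem_closure_iff hendb.1, hc.shift, sub_self]
    -- The retracted path starts in `closure Ω`, stays in `closure Ω ∪ closure W`, and ends in
    -- `closure W`, where `P` fixes the endpoint. At the first hitting time it is in both closures,
    -- hence in `Γ`.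
    obtain ⟨s, hs, hsAB, hB⟩ := exists_first_time (γ := fun s : ℝ => P (x + s • f))
      (A := closure W) (B := closure Ω) (hP.continuous.comp (by fun_prop)) isClosed_closure
      isClosed_closure (hpos x hx).le (fun s hs => by
        have hb := hball (hseg x hx s hs)
        exact (hND ⟨(hPV _ hb.2.1).1, hb.2.2.2⟩).symm)
      (by simpa [hPx] using subset_closure hx.1)
      (by simpa only [(hPV _ hendb.2.1).2 (hWD' hendW)] using hendW)
    exact ⟨s, hs, hWΓ hsAB, hB⟩
  refine ⟨r, hr, M ^ 2 * L ^ 2 * (4 * (1 + L ^ 3)), fun u g hu => ?_⟩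
  have hBm : MeasurableSet (Ω ∩ Metric.ball p r) := (hΩ.inter Metric.isOpen_ball).measurableSet
  have hgm := hu.hasH1Gradient.memLp_gradient.aestronglyMeasurable.aemeasurable
  have hae := hu.ae_enorm_le hfr hΓm hΓ hgm.measurable_mk hgm.ae_eq_mk hP hR hPR hc.norm_dir
    hc.null_cylinder hBm inter_subset_left (fun x hx => hτle x hx.2) hpath
  set G : E3 → ℝ≥0∞ := (closure Ω).indicator fun y => ‖hgm.mk g y‖ₑ with hG
  have hGm : Measurable G := hgm.measurable_mk.enorm.indicator isClosed_closure.measurableSet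
  have hcl : volume.restrict (closure Ω) = volume.restrict Ω := by
    refine Measure.restrict_congr_set ?_
    rw [closure_eq_self_union_frontier]
    exact union_ae_eq_left_of_ae_eq_empty (ae_eq_empty.2 hfr)
  have hG2 : ∫⁻ x, G x ^ 2 = ∫⁻ x in Ω, ‖g x‖ₑ ^ 2 := by
    have e : ∀ x, G x ^ 2 = (closure Ω).indicator (fun y => ‖hgm.mk g y‖ₑ ^ 2) x := fun x => by
      by_cases h : x ∈ closure Ω <;> simp [G, h]
    simp_rw [e]
    rw [lintegral_indicator isClosed_closure.measurableSet, hcl]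
    refine lintegral_congr_ae ?_
    filter_upwards [hgm.ae_eq_mk] with x hx
    rw [hx]
  calc ∫⁻ x in Ω ∩ Metric.ball p r, (‖u x‖ₑ / Metric.infEDist x Γ) ^ 2
      ≤ ∫⁻ x in Ω ∩ Metric.ball p r, (M : ℝ≥0∞) ^ 2 * (L : ℝ≥0∞) ^ 2 *
          ((∫⁻ s in Ioo 0 (τ x), G (P (x + s • f))) / ENNReal.ofReal (τ x)) ^ 2 := by
        refine lintegral_mono_ae ?_
        filter_upwards [hae, ae_restrict_mem hBm] with x hx hxB
        have hτ0 : ENNReal.ofReal (τ x) ≠ 0 := by simpa using hpos x hxB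
        rw [← mul_pow, ← mul_pow]
        gcongr
        refine ENNReal.div_le_of_le_mul (hx.trans ?_)
        calc _ = L * ((∫⁻ s in Ioo 0 (τ x), G (P (x + s • f))) / ENNReal.ofReal (τ x) *
              ENNReal.ofReal (τ x)) := by
              rw [ENNReal.div_mul_cancel hτ0 ENNReal.ofReal_ne_top]
          _ ≤ L * ((∫⁻ s in Ioo 0 (τ x), G (P (x + s • f))) / ENNReal.ofReal (τ x) *
              (M * Metric.infEDist x Γ)) := by gcongr; exact hdist x hxB
          _ = _ := by ring
    _ = (M : ℝ≥0∞) ^ 2 * (L : ℝ≥0∞) ^ 2 * ∫⁻ x in Ω ∩ Metric.ball p r,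
          ((∫⁻ s in Ioo 0 (τ x), G (P (x + s • f))) / ENNReal.ofReal (τ x)) ^ 2 :=
        lintegral_const_mul' _ _ (by finiteness)
    _ ≤ (M : ℝ≥0∞) ^ 2 * (L : ℝ≥0∞) ^ 2 * (4 * (((1 + L ^ 3 : ℝ≥0) : ℝ≥0∞) *
          ∫⁻ x, G x ^ 2)) := by
        gcongr
        refine (lintegral_mono_set (show Ω ∩ Metric.ball p r ⊆ {x | 0 < τ x} from hpos)).trans ?_
        refine (hardy_directional hc.lipschitz.continuous.measurable hc.shift
          (hGm.comp hP.continuous.measurable)).trans ?_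
        gcongr
        exact lintegral_comp_le hP.continuous.measurable hR hPR (hGm.pow_const 2)
    _ = _ := by
        rw [hG2]
        push_cast
        ring

/-! ### Comparing `L²` norms under translation -/

lemma lintegral_sq_le_of_le_add {α : Type*} [MeasurableSpace α] {μ : Measure α}
    {a b c : α → ℝ≥0∞} (hb : AEMeasurable b μ) (h : ∀ᵐ x ∂μ, a x ≤ b x + c x) :
    ∫⁻ x, a x ^ 2 ∂μ ≤ 2 * (∫⁻ x, b x ^ 2 ∂μ) + 2 * ∫⁻ x, c x ^ 2 ∂μ := by
  rw [← lintegral_const_mul' _ _ ENNReal.ofNat_ne_top,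
    ← lintegral_const_mul' _ _ ENNReal.ofNat_ne_top,
    ← lintegral_add_left' ((hb.pow_const 2).const_mul 2)]
  refine lintegral_mono_ae ?_
  filter_upwards [h] with x hx
  have h2 := ENNReal.rpow_add_le_mul_rpow_add_rpow (b x) (c x) (p := 2) (by norm_num)
  have e : (2 : ℝ≥0∞) ^ ((2 : ℝ) - 1) = 2 := by norm_num
  rw [e] at h2
  simp only [ENNReal.rpow_two] at h2
  calc a x ^ 2 ≤ (b x + c x) ^ 2 := by gcongr
    _ ≤ _ := h2.trans (le_of_eq (mul_add _ _ _))

lemma setLIntegral_translate_le {V V' : Set E3} (hV : MeasurableSet V) (hV' : MeasurableSet V')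
    {z : E3} (hz : ∀ x ∈ V, x + z ∈ V') (F : E3 → ℝ≥0∞) :
    ∫⁻ x in V, F (x + z) ≤ ∫⁻ x in V', F x := by
  rw [← lintegral_indicator hV, ← lintegral_indicator hV',
    ← lintegral_add_right_eq_self (V'.indicator F) z]
  refine lintegral_mono fun x => ?_
  by_cases hx : x ∈ V
  · rw [indicator_of_mem hx, indicator_of_mem (hz x hx)]
  · rw [indicator_of_notMem hx]; exact zero_le

/-- The difference `φ (x + z) - φ x` is at most `‖z‖` times the gradient integral over the segment.
After squaring, each slice `s` is a translate of `V` inside `Ω`. -/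
lemma lintegral_translate_le_of_contDiff {φ : E3 → ℝ} (hφ : ContDiff ℝ ∞ φ) {Ω V V' : Set E3}
    (hΩ : IsOpen Ω) {z : E3} (hVm : MeasurableSet V) (hVm' : MeasurableSet V')
    (hz : ∀ x ∈ V, x + z ∈ V') (hV : ∀ x ∈ V, ∀ s ∈ Icc (0 : ℝ) 1, x + s • z ∈ Ω) :
    ∫⁻ x in V, ‖φ x‖ₑ ^ 2 ≤ 2 * (∫⁻ x in V', ‖φ x‖ₑ ^ 2) +
      2 * (‖z‖ₑ ^ 2 * ∫⁻ x in Ω, ‖gradient φ x‖ₑ ^ 2) := by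
  have hgm : Measurable fun y => ‖gradient φ y‖ₑ := (continuous_gradient hφ).measurable.enorm
  have hpt : ∀ x, ‖φ x‖ₑ ≤ ‖φ (x + z)‖ₑ + ‖z‖ₑ * ∫⁻ s in Ioc (0 : ℝ) 1, ‖gradient φ (x + s • z)‖ₑ := by
    intro x
    have hγ : LipschitzWith ‖z‖₊ fun s : ℝ => x + s • z := by
      refine LipschitzWith.of_dist_le_mul fun a b => ?_
      rw [dist_add_left, dist_eq_norm, ← sub_smul, norm_smul, dist_eq_norm, mul_comm]
      exact le_rfl
    have h := enorm_sub_le_lintegral_path hφ hγ zero_le_one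
    simp only [zero_smul, add_zero, one_smul] at h
    calc ‖φ x‖ₑ = ‖φ (x + z) - (φ (x + z) - φ x)‖ₑ := by congr 1; ring
      _ ≤ _ := enorm_sub_le.trans (by gcongr; exact h)
  refine (lintegral_sq_le_of_le_add (((hφ.continuous.comp
    (continuous_id.add continuous_const)).measurable.enorm).aemeasurable)
    (Eventually.of_forall hpt)).trans ?_
  gcongr ?_ + ?_
  · gcongr 2 * ?_
    exact setLIntegral_translate_le hVm hVm' hz fun x => ‖φ x‖ₑ ^ 2
  · gcongr
    have hm : Measurable (Function.uncurry fun (x : E3) (s : ℝ) => ‖gradient φ (x + s • z)‖ₑ ^ 2) :=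
      (hgm.comp (measurable_fst.add (measurable_snd.smul_const z))).pow_const 2
    calc ∫⁻ x in V, (‖z‖ₑ * ∫⁻ s in Ioc (0 : ℝ) 1, ‖gradient φ (x + s • z)‖ₑ) ^ 2
        ≤ ∫⁻ x in V, ‖z‖ₑ ^ 2 * ∫⁻ s in Ioc (0 : ℝ) 1, ‖gradient φ (x + s • z)‖ₑ ^ 2 := by
          refine lintegral_mono fun x => ?_
          have := sq_lintegral_Ioc_le (f := fun s => ‖gradient φ (x + s • z)‖ₑ)
            (hgm.comp (measurable_const.add (measurable_id.smul_const z))) 1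
          rw [ENNReal.ofReal_one, one_mul] at this
          simp only [mul_pow]
          gcongr
      _ = ‖z‖ₑ ^ 2 * ∫⁻ s in Ioc (0 : ℝ) 1, ∫⁻ x in V, ‖gradient φ (x + s • z)‖ₑ ^ 2 := by
          rw [lintegral_const_mul' _ _ (by finiteness),
            lintegral_lintegral_swap hm.aemeasurable]
      _ ≤ ‖z‖ₑ ^ 2 * ∫⁻ s in Ioc (0 : ℝ) 1, ∫⁻ x in Ω, ‖gradient φ x‖ₑ ^ 2 := by
          gcongr _ * ?_
          refine setLIntegral_mono' measurableSet_Ioc fun s hs => ?_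
          exact setLIntegral_translate_le hVm hΩ.measurableSet
            (fun x hx => hV x hx s ⟨hs.1.le, hs.2⟩) fun x => ‖gradient φ x‖ₑ ^ 2
      _ = _ := by simp

/-- Comparison of the `L²` norms of an `H¹` function on a set and on a translate of it. -/
lemma MemH1Zero.lintegral_translate_le {Ω Γ : Set E3} {u : E3 → ℝ} {g : E3 → E3}
    (hu : MemH1Zero Ω Γ u g) (hΩ : IsOpen Ω) {V V' : Set E3} {z : E3} (hVm : MeasurableSet V)
    (hVm' : MeasurableSet V') (hV' : V' ⊆ Ω) (hz : ∀ x ∈ V, x + z ∈ V')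
    (hV : ∀ x ∈ V, ∀ s ∈ Icc (0 : ℝ) 1, x + s • z ∈ Ω) :
    ∫⁻ x in V, ‖u x‖ₑ ^ 2 ≤ 8 * (∫⁻ x in V', ‖u x‖ₑ ^ 2) +
      8 * ‖z‖ₑ ^ 2 * ∫⁻ x in Ω, ‖g x‖ₑ ^ 2 := by
  obtain ⟨t, ⟨ht, φ, hφ, hφu, hφg, hφt⟩, ht0⟩ := hu.trace_zero
  have hVΩ : V ⊆ Ω := fun x hx => by simpa using hV x hx 0 ⟨le_rfl, zero_le_one⟩
  have hum := hu.hasH1Gradient.memLp.aestronglyMeasurable.aemeasurable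
  have hgm := hu.hasH1Gradient.memLp_gradient.aestronglyMeasurable.aemeasurable
  have hdm : ∀ n, AEMeasurable (fun x => ‖φ n x - u x‖ₑ) (volume.restrict Ω) := fun n =>
    ((hφ n).continuous.measurable.aemeasurable.sub hum).enorm
  have hdgm : ∀ n, AEMeasurable (fun x => ‖gradient (φ n) x - g x‖ₑ) (volume.restrict Ω) :=
    fun n => ((continuous_gradient (hφ n)).measurable.aemeasurable.sub hgm).enorm
  let ε : ℕ → ℝ≥0∞ := fun n => ∫⁻ x in Ω, ‖φ n x - u x‖ₑ ^ 2
  let δ : ℕ → ℝ≥0∞ := fun n => ∫⁻ x in Ω, ‖gradient (φ n) x - g x‖ₑ ^ 2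
  have h1 : ∀ n, ∫⁻ x in V, ‖u x‖ₑ ^ 2 ≤ 2 * ε n + 2 * ∫⁻ x in V, ‖φ n x‖ₑ ^ 2 := fun n => by
    refine (lintegral_sq_le_of_le_add (b := fun x => ‖φ n x - u x‖ₑ) (c := fun x => ‖φ n x‖ₑ)
      ((hdm n).mono_set hVΩ) (Eventually.of_forall fun x => ?_)).trans ?_
    · calc ‖u x‖ₑ = ‖-(φ n x - u x) + φ n x‖ₑ := by congr 1; ring
        _ ≤ _ := (enorm_add_le _ _).trans (by rw [enorm_neg])
    · gcongr
      exact lintegral_mono_set hVΩ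
  have h2 : ∀ n, ∫⁻ x in V', ‖φ n x‖ₑ ^ 2 ≤ 2 * ε n + 2 * ∫⁻ x in V', ‖u x‖ₑ ^ 2 := fun n => by
    refine (lintegral_sq_le_of_le_add (b := fun x => ‖φ n x - u x‖ₑ) (c := fun x => ‖u x‖ₑ)
      ((hdm n).mono_set hV') (Eventually.of_forall fun x => ?_)).trans ?_
    · calc ‖φ n x‖ₑ = ‖(φ n x - u x) + u x‖ₑ := by congr 1; ring
        _ ≤ _ := enorm_add_le _ _
    · gcongr
      exact lintegral_mono_set hV'
  have h3 : ∀ n, ∫⁻ x in Ω, ‖gradient (φ n) x‖ₑ ^ 2 ≤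
      2 * δ n + 2 * ∫⁻ x in Ω, ‖g x‖ₑ ^ 2 := fun n => by
    refine lintegral_sq_le_of_le_add (b := fun x => ‖gradient (φ n) x - g x‖ₑ)
      (c := fun x => ‖g x‖ₑ) (hdgm n) (Eventually.of_forall fun x => ?_)
    calc ‖gradient (φ n) x‖ₑ = ‖(gradient (φ n) x - g x) + g x‖ₑ := by rw [sub_add_cancel]
      _ ≤ _ := enorm_add_le _ _
  have h4 : ∀ n, ∫⁻ x in V, ‖u x‖ₑ ^ 2 ≤ 10 * ε n + 8 * ‖z‖ₑ ^ 2 * δ n +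
      (8 * (∫⁻ x in V', ‖u x‖ₑ ^ 2) + 8 * ‖z‖ₑ ^ 2 * ∫⁻ x in Ω, ‖g x‖ₑ ^ 2) := fun n => by
    have h5 := lintegral_translate_le_of_contDiff (hφ n) hΩ hVm hVm' hz hV
    calc ∫⁻ x in V, ‖u x‖ₑ ^ 2 ≤ 2 * ε n + 2 * (2 * (2 * ε n + 2 * ∫⁻ x in V', ‖u x‖ₑ ^ 2) +
          2 * (‖z‖ₑ ^ 2 * (2 * δ n + 2 * ∫⁻ x in Ω, ‖g x‖ₑ ^ 2))) := by
          refine (h1 n).trans ?_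
          gcongr
          refine h5.trans ?_
          gcongr
          · exact h2 n
          · exact h3 n
      _ = _ := by ring
  have hlim : Tendsto (fun n => 10 * ε n + 8 * ‖z‖ₑ ^ 2 * δ n +
      (8 * (∫⁻ x in V', ‖u x‖ₑ ^ 2) + 8 * ‖z‖ₑ ^ 2 * ∫⁻ x in Ω, ‖g x‖ₑ ^ 2)) atTop
      (𝓝 (10 * 0 + 8 * ‖z‖ₑ ^ 2 * 0 +
      (8 * (∫⁻ x in V', ‖u x‖ₑ ^ 2) + 8 * ‖z‖ₑ ^ 2 * ∫⁻ x in Ω, ‖g x‖ₑ ^ 2))) :=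
    ((ENNReal.Tendsto.const_mul hφu (Or.inr (by finiteness))).add
      (ENNReal.Tendsto.const_mul hφg (Or.inr (by finiteness)))).add tendsto_const_nhds
  rw [mul_zero, mul_zero, zero_add, zero_add] at hlim
  exact ge_of_tendsto' hlim h4

/-! ### Isolating one component of the Dirichlet part -/

lemma disjoint_closure_of_areSeparated {A B : Set E3} (h : Metric.AreSeparated A B) {x : E3}
    (hA : x ∈ closure A) : x ∉ closure B := by
  intro hB
  obtain ⟨r, hr, hAB⟩ := h
  have hr2 : 0 < r / 2 := ENNReal.half_pos hr
  obtain ⟨a, ha, hxa⟩ := EMetric.mem_closure_iff.1 hA _ hr2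
  obtain ⟨b, hb, hxb⟩ := EMetric.mem_closure_iff.1 hB _ hr2
  have h1 := (hAB a ha b hb).trans (edist_triangle_left a b x)
  have h2 := ENNReal.add_lt_add hxa hxb
  rw [ENNReal.add_halves] at h2
  exact absurd h1 (not_le.2 h2)

lemma mem_component {Γ : Set E3} {p : E3} (hp : p ∈ Γ) :
    connectedComponentIn Γ p ∈ components Γ ∧ p ∈ connectedComponentIn Γ p :=
  ⟨mem_image_of_mem _ hp, mem_connectedComponentIn hp⟩

/-- Each component is an intersection of two closures, and there are finitely many. -/
lemma IsDirichletPart.isClosed {Ω Γ : Set E3} (h : IsDirichletPart Ω Γ) : IsClosed Γ := by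
  obtain ⟨W, hW, -, -⟩ := h.attached
  have e : Γ = ⋃ S ∈ components Γ, S := by
    refine Subset.antisymm (fun p hp => ?_) (iUnion₂_subset ?_)
    · exact mem_biUnion (mem_component hp).1 (mem_component hp).2
    · rintro _ ⟨p, hp, rfl⟩
      exact connectedComponentIn_subset Γ p
  rw [e]
  refine h.finite_components.isClosed_biUnion fun S hS => ?_
  rw [← (hW S hS).2.1]
  exact isClosed_closure.inter isClosed_closure

lemma IsDirichletPart.hardyNear {Ω Γ : Set E3} (hΓ : IsDirichletPart Ω Γ)
    (hΩ : IsLipschitzPolyhedron Ω) {p : E3} (hp : p ∈ Γ) : HardyNear Ω Γ p := by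
  obtain ⟨W, hW, hsep, hD⟩ := hΓ.attached
  obtain ⟨hS, hpS⟩ := mem_component hp
  set S := connectedComponentIn Γ p with hSdef
  obtain ⟨hWL, hWS, hWΩ⟩ := hW S hS
  have hpW : p ∈ closure (W S) ∩ closure Ω := by rwa [hWS]
  -- The complement of this set is the neighbourhood of `p` in which only the domain attached to the
  -- component of `p` is visible; `p` belongs to it by the positive distances.
  have hN : IsClosed (⋃ T ∈ components Γ \ {S}, closure (W T)) :=
    (hΓ.finite_components.subset sdiff_subset).isClosed_biUnion fun _ _ => isClosed_closure
  have hE : IsClosed (closure Ω ∪ ⋃ T ∈ components Γ, closure (W T)) :=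
    isClosed_closure.union (hΓ.finite_components.isClosed_biUnion fun _ _ => isClosed_closure)
  refine hardyNear_of_attached hΩ.isOpen hΩ.volume_frontier hΓ.isClosed.measurableSet
    hΓ.subset_frontier hWL hWΩ ?_ hD ?_ ?_ hpW.1 hpW.2 (hN.isOpen_compl.mem_nhds ?_) ?_ ?_
  · rw [hWS]; exact connectedComponentIn_subset Γ p
  · exact (interior_maximal (subset_closure.trans subset_union_left) hΩ.isOpen).trans
      subset_closure
  · refine (interior_maximal ?_ hWL.isOpen).trans subset_closure
    exact subset_closure.trans ((subset_biUnion_of_mem (u := fun T => closure (W T)) hS).trans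
      subset_union_right)
  · simp only [mem_compl_iff, mem_iUnion, not_exists]
    intro T hT
    exact disjoint_closure_of_areSeparated (hsep S hS T hT.1 fun h => hT.2 h.symm) hpW.1
  · rintro x ⟨hxD, hxN⟩
    rcases closure_minimal interior_subset hE hxD with h | h
    · exact Or.inl h
    · obtain ⟨T, hT, hxT⟩ := mem_iUnion₂.1 h
      right
      by_cases hTS : T = S
      · rwa [← hTS]
      · exact absurd (mem_biUnion (show T ∈ components Γ \ {S} from ⟨hT, hTS⟩) hxT) hxN
  · rintro q ⟨hq, hqN⟩
    obtain ⟨hT, hqT⟩ := mem_component hq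
    have hqW : q ∈ closure (W (connectedComponentIn Γ q)) := by
      rw [← (hW _ hT).2.1] at hqT
      exact hqT.1
    by_cases hTS : connectedComponentIn Γ q = S
    · rwa [hTS] at hqW
    · exact absurd (mem_biUnion (show _ ∈ components Γ \ {S} from ⟨hT, hTS⟩) hqW) hqN

/-! ### From Hardy to Poincaré bounds and back -/

/-- On a ball the distance to `Γ` is bounded by the distance to a fixed `q ∈ Γ`, so the Hardy weight
is bounded below. -/
lemma HardyNear.poincareNear {Ω Γ : Set E3} (hΩ : IsOpen Ω) {p q : E3} (h : HardyNear Ω Γ p) (hq : q ∈ Γ) :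
    PoincareNear Ω Γ p := by
  obtain ⟨r, hr, C, hC⟩ := h
  set A : ℝ≥0 := Real.toNNReal (r + dist p q) with hA
  have hA0 : A ≠ 0 := by
    rw [hA, Ne, Real.toNNReal_eq_zero, not_le]; positivity
  refine ⟨r, hr, A ^ 2 * C, fun u g hu => ?_⟩
  have hle : ∀ x ∈ Metric.ball p r, ‖u x‖ₑ ^ 2 ≤
      (A : ℝ≥0∞) ^ 2 * (‖u x‖ₑ / Metric.infEDist x Γ) ^ 2 := by
    intro x hx
    have h1 : Metric.infEDist x Γ ≤ A := by
      refine (Metric.infEDist_le_edist_of_mem hq).trans ?_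
      rw [edist_dist]
      refine ENNReal.ofReal_le_ofReal ?_
      linarith [dist_triangle x p q, Metric.mem_ball.1 hx]
    rw [← mul_pow]
    gcongr
    calc ‖u x‖ₑ = A * (‖u x‖ₑ / A) :=
          (ENNReal.mul_div_cancel (by simpa using hA0) ENNReal.coe_ne_top).symm
      _ ≤ _ := by gcongr
  calc ∫⁻ x in Ω ∩ Metric.ball p r, ‖u x‖ₑ ^ 2
      ≤ ∫⁻ x in Ω ∩ Metric.ball p r, (A : ℝ≥0∞) ^ 2 * (‖u x‖ₑ / Metric.infEDist x Γ) ^ 2 := by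
        exact setLIntegral_mono' (hΩ.inter Metric.isOpen_ball).measurableSet
          fun x hx => hle x hx.2
    _ = (A : ℝ≥0∞) ^ 2 * ∫⁻ x in Ω ∩ Metric.ball p r, (‖u x‖ₑ / Metric.infEDist x Γ) ^ 2 :=
        lintegral_const_mul' _ _ (by finiteness)
    _ ≤ (A : ℝ≥0∞) ^ 2 * (C * ∫⁻ x in Ω, ‖g x‖ₑ ^ 2) := by gcongr; exact hC u g hu
    _ = _ := by push_cast; ring

lemma PoincareNear.hardyNear {Ω Γ : Set E3} (hΩ : IsOpen Ω) (hΓ : IsClosed Γ) {p : E3}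
    (h : PoincareNear Ω Γ p) (hp : p ∉ Γ) : HardyNear Ω Γ p := by
  obtain ⟨r, hr, C, hC⟩ := h
  obtain ⟨η, hη, hball⟩ := Metric.mem_nhds_iff.1 (hΓ.isOpen_compl.mem_nhds hp)
  set A : ℝ≥0 := Real.toNNReal (η / 2) with hA
  have hA0 : A ≠ 0 := by
    rw [hA, Ne, Real.toNNReal_eq_zero, not_le]; positivity
  refine ⟨min r (η / 2), by positivity, (A⁻¹) ^ 2 * C, fun u g hu => ?_⟩
  have hm : MeasurableSet (Ω ∩ Metric.ball p (min r (η / 2))) :=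
    (hΩ.inter Metric.isOpen_ball).measurableSet
  calc ∫⁻ x in Ω ∩ Metric.ball p (min r (η / 2)), (‖u x‖ₑ / Metric.infEDist x Γ) ^ 2
      ≤ ∫⁻ x in Ω ∩ Metric.ball p (min r (η / 2)), ((A⁻¹ : ℝ≥0) : ℝ≥0∞) ^ 2 * ‖u x‖ₑ ^ 2 := by
        refine setLIntegral_mono' hm fun x hx => ?_
        have h1 : (A : ℝ≥0∞) ≤ Metric.infEDist x Γ := by
          rw [Metric.le_infEDist]
          intro q hq
          rw [edist_dist]
          refine ENNReal.ofReal_le_ofReal ?_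
          by_contra! hlt
          refine hball (show q ∈ Metric.ball p η from ?_) hq
          have h2 := (Metric.mem_ball.1 hx.2).trans_le (min_le_right _ _)
          have h3 := dist_triangle_left q p x
          rw [Metric.mem_ball]
          linarith
        rw [← mul_pow]
        gcongr
        rw [ENNReal.coe_inv hA0, mul_comm, ← div_eq_mul_inv]
        gcongr
    _ = ((A⁻¹ : ℝ≥0) : ℝ≥0∞) ^ 2 *
          ∫⁻ x in Ω ∩ Metric.ball p (min r (η / 2)), ‖u x‖ₑ ^ 2 :=
        lintegral_const_mul' _ _ (by finiteness)
    _ ≤ ((A⁻¹ : ℝ≥0) : ℝ≥0∞) ^ 2 * (C * ∫⁻ x in Ω, ‖g x‖ₑ ^ 2) := by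
        gcongr
        refine le_trans (lintegral_mono_set ?_) (hC u g hu)
        exact inter_subset_inter_right _ (Metric.ball_subset_ball (min_le_left _ _))
    _ = _ := by push_cast; ring

lemma PoincareNear.of_mem_ball {Ω Γ : Set E3} {p : E3} (h : PoincareNear Ω Γ p) :
    ∃ r > 0, ∀ q ∈ Metric.ball p r, PoincareNear Ω Γ q := by
  obtain ⟨r, hr, C, hC⟩ := h
  refine ⟨r, hr, fun q hq => ⟨r - dist q p, sub_pos.2 hq, C, fun u g hu => ?_⟩⟩
  refine le_trans (lintegral_mono_set ?_) (hC u g hu)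
  exact inter_subset_inter_right _ (Metric.ball_subset_ball' (by linarith))

/-- The `L²` norm near `p` is compared with that near `p + z`, at the cost of the gradient along
segments that stay in `Ω`. -/
lemma PoincareNear.translate {Ω Γ : Set E3} (hΩ : IsOpen Ω) {p z : E3}
    (h : PoincareNear Ω Γ (p + z)) {ρ : ℝ} (hρ : 0 < ρ)
    (hseg : ∀ x ∈ Ω ∩ Metric.ball p ρ, ∀ s ∈ Icc (0 : ℝ) 1, x + s • z ∈ Ω) :
    PoincareNear Ω Γ p := by
  obtain ⟨r, hr, C, hC⟩ := h
  refine ⟨min r ρ, lt_min hr hρ, 8 * C + 8 * ‖z‖₊ ^ 2, fun u g hu => ?_⟩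
  have hseg' : ∀ x ∈ Ω ∩ Metric.ball p (min r ρ), ∀ s ∈ Icc (0 : ℝ) 1, x + s • z ∈ Ω :=
    fun x hx => hseg x ⟨hx.1, Metric.ball_subset_ball (min_le_right _ _) hx.2⟩
  refine (hu.lintegral_translate_le hΩ (V := Ω ∩ Metric.ball p (min r ρ))
    (V' := Ω ∩ Metric.ball (p + z) r) (z := z) (hΩ.inter Metric.isOpen_ball).measurableSet
    (hΩ.inter Metric.isOpen_ball).measurableSet inter_subset_left (fun x hx => ⟨?_, ?_⟩)
    hseg').trans ?_
  · simpa using hseg' x hx 1 ⟨zero_le_one, le_rfl⟩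
  · rw [Metric.mem_ball, dist_add_right]
    exact (Metric.mem_ball.1 hx.2).trans_le (min_le_left _ _)
  · calc _ ≤ 8 * (C * ∫⁻ x in Ω, ‖g x‖ₑ ^ 2) + 8 * ‖z‖ₑ ^ 2 * ∫⁻ x in Ω, ‖g x‖ₑ ^ 2 := by
          gcongr; exact hC u g hu
      _ = _ := by
          rw [enorm_eq_nnnorm]; push_cast; ring

/-- Within `Ω`, the points with a local bound form an open and relatively closed subset, nonempty
because `q` is a limit of points of `Ω`; connectedness makes it all of `Ω`. A boundary point is then
reached by translating inward along a chart direction. -/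
lemma IsLipschitzDomain.poincareNear {Ω Γ : Set E3} (hΩ : IsLipschitzDomain Ω) {q : E3}
    (hq : q ∈ closure Ω) (hP : PoincareNear Ω Γ q) {p : E3} (hp : p ∈ closure Ω) :
    PoincareNear Ω Γ p := by
  have hopen : IsOpen ({x | PoincareNear Ω Γ x} ∩ Ω) := by
    refine IsOpen.inter (Metric.isOpen_iff.2 fun x hx => ?_) hΩ.isOpen
    exact PoincareNear.of_mem_ball hx
  have hsub : Ω ⊆ {x | PoincareNear Ω Γ x} ∩ Ω := by
    refine hΩ.isConnected.isPreconnected.subset_of_closure_inter_subset hopen ?_ ?_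
    · obtain ⟨r, hr, hball⟩ := hP.of_mem_ball
      obtain ⟨y, hy, hyΩ⟩ := mem_closure_iff_nhds.1 hq _ (Metric.ball_mem_nhds q hr)
      exact ⟨y, hyΩ, hball y hy, hyΩ⟩
    · rintro x ⟨hxc, hxΩ⟩
      refine ⟨?_, hxΩ⟩
      obtain ⟨R, hR, hball⟩ := Metric.mem_nhds_iff.1 (hΩ.isOpen.mem_nhds hxΩ)
      obtain ⟨y, hy, hyP, -⟩ := mem_closure_iff_nhds.1 hxc _
        (Metric.ball_mem_nhds x (half_pos hR))
      -- The translation has length less than `R / 2`, so segments starting in the ball of radius `R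
      -- / 2` about `x` stay in the ball of radius `R` inside `Ω`.
      refine PoincareNear.translate (z := y - x) (ρ := R / 2) hΩ.isOpen
        (by rw [add_sub_cancel]; exact hyP) (half_pos hR) fun w hw s hs => hball ?_
      have h1 := Metric.mem_ball.1 hw.2
      have h2 := Metric.mem_ball.1 hy
      have h3 : dist (w + s • (y - x)) w ≤ dist y x := by
        rw [dist_eq_norm, add_sub_cancel_left, norm_smul, Real.norm_eq_abs, abs_of_nonneg hs.1,
          ← dist_eq_norm]
        exact mul_le_of_le_one_left dist_nonneg hs.2
      rw [Metric.mem_ball]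
      linarith [dist_triangle (w + s • (y - x)) w x]
  by_cases hpΩ : p ∈ Ω
  · exact (hsub hpΩ).1
  obtain ⟨V, τ, M, f, hc, hpV⟩ := hΩ.exists_chart (p := p) (by
    rw [hΩ.isOpen.frontier_eq]; exact ⟨hp, hpΩ⟩)
  obtain ⟨R, hR, hball⟩ := Metric.mem_nhds_iff.1 (hc.isOpen.mem_nhds hpV)
  have hmove : ∀ x, dist x p < R / 2 → ∀ s ∈ Icc (0 : ℝ) 1, x + s • (R / 2) • f ∈ V := by
    intro x hx s hs
    refine hball ?_
    have h3 : dist (x + s • (R / 2) • f) x ≤ R / 2 := by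
      rw [dist_eq_norm, add_sub_cancel_left, norm_smul, norm_smul, hc.norm_dir, Real.norm_eq_abs,
        Real.norm_eq_abs, abs_of_nonneg hs.1, abs_of_pos (half_pos hR), mul_one]
      exact mul_le_of_le_one_left (half_pos hR).le hs.2
    rw [Metric.mem_ball]
    linarith [dist_triangle (x + s • (R / 2) • f) x p]
  have hpz : p + (R / 2) • f ∈ Ω := by
    have h1 := hmove p (by simpa using half_pos hR) 1 ⟨zero_le_one, le_rfl⟩
    rw [one_smul] at h1
    rw [hc.mem_iff _ h1, hc.shift]
    linarith [(hc.mem_closure_iff hpV).1 hp]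
  refine PoincareNear.translate hΩ.isOpen (hsub hpz).1 (half_pos hR) fun x hx s hs => ?_
  have h1 := hmove x hx.2 s hs
  have hxV : x ∈ V := hball (Metric.ball_subset_ball (by linarith) hx.2)
  rw [hc.mem_iff _ h1, smul_smul, hc.shift]
  have h2 := (hc.mem_iff x hxV).1 hx.1
  have h3 : 0 ≤ s * (R / 2) := mul_nonneg hs.1 (half_pos hR).le
  linarith

/-! ### Compactness and conclusion -/

lemma IsDirichletPart.exists_hardy_const {Ω Γ : Set E3} (hΓ : IsDirichletPart Ω Γ)
    (hΩ : IsLipschitzPolyhedron Ω) (hne : Γ.Nonempty) :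
    ∃ C : ℝ≥0, ∀ (u : E3 → ℝ) (g : E3 → E3), MemH1Zero Ω Γ u g →
      ∫⁻ x in Ω ∩ closure Ω, (‖u x‖ₑ / Metric.infEDist x Γ) ^ 2 ≤
        C * ∫⁻ x in Ω, ‖g x‖ₑ ^ 2 := by
  obtain ⟨q, hq⟩ := hne
  have hqΩ : q ∈ closure Ω := frontier_subset_closure (hΓ.subset_frontier hq)
  have hP := (hΓ.hardyNear hΩ hq).poincareNear hΩ.isOpen hq
  have hall : ∀ p ∈ closure Ω, HardyNear Ω Γ p := fun p hp => by
    by_cases hpΓ : p ∈ Γ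
    · exact hΓ.hardyNear hΩ hpΓ
    · exact (hΩ.toIsLipschitzDomain.poincareNear hqΩ hP hp).hardyNear hΩ.isOpen hΓ.isClosed hpΓ
  refine hΩ.isCompact_closure.induction_on (p := fun s => ∃ C : ℝ≥0, ∀ (u : E3 → ℝ)
    (g : E3 → E3), MemH1Zero Ω Γ u g →
      ∫⁻ x in Ω ∩ s, (‖u x‖ₑ / Metric.infEDist x Γ) ^ 2 ≤ C * ∫⁻ x in Ω, ‖g x‖ₑ ^ 2) ?_ ?_ ?_ ?_
  · exact ⟨0, fun u g _ => by simp⟩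
  · rintro s t hst ⟨C, hC⟩
    exact ⟨C, fun u g hu => (lintegral_mono_set (inter_subset_inter_right _ hst)).trans
      (hC u g hu)⟩
  · rintro s t ⟨C, hC⟩ ⟨C', hC'⟩
    refine ⟨C + C', fun u g hu => ?_⟩
    rw [inter_union_distrib_left, ENNReal.coe_add, add_mul]
    exact (lintegral_union_le _ _ _).trans (add_le_add (hC u g hu) (hC' u g hu))
  · intro p hp
    obtain ⟨r, hr, C, hC⟩ := hall p hp
    exact ⟨Metric.ball p r, mem_nhdsWithin_of_mem_nhds (Metric.ball_mem_nhds p hr), C, hC⟩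

end HardyMixed

/-- Generalized Hardy inequality. The distance to `Γ` is taken in `[0, ∞]`, so that it is `∞`
(and the left-hand side vanishes) for `Γ = ∅`. -/
theorem theorem5p2 (Ω Γ : Set HardyMixed.E3) (hΩ : HardyMixed.IsLipschitzPolyhedron Ω)
    (hΓ : HardyMixed.IsDirichletPart Ω Γ) :
    ∃ C : ℝ, 0 < C ∧ ∀ (u : HardyMixed.E3 → ℝ) (g : HardyMixed.E3 → HardyMixed.E3),
      HardyMixed.MemH1Zero Ω Γ u g →
        ∫⁻ x in Ω, (‖u x‖ₑ / Metric.infEDist x Γ) ^ 2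
          ≤ ENNReal.ofReal C * ∫⁻ x in Ω, ‖g x‖ₑ ^ 2 := by
  rcases Γ.eq_empty_or_nonempty with rfl | hne
  · exact ⟨1, one_pos, fun u g _ => by simp⟩
  obtain ⟨C, hC⟩ := hΓ.exists_hardy_const hΩ hne
  -- `C` may be zero, while the constant must be positive.
  refine ⟨C + 1, by positivity, fun u g hu => ?_⟩
  have h := hC u g hu
  rw [inter_eq_left.2 subset_closure] at h
  refine h.trans ?_
  gcongr
  rw [← ENNReal.ofReal_coe_nnreal]
  exact ENNReal.ofReal_le_ofReal (by linarith)
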